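/- Let $e\ge 2$, $n\ge 2$ and $1\le k\le e-1$. Let $G(e,e,n)$ be the group of $n\times n$ complex monomial matrices whose nonzero entries are $e$-th roots of unity with product $1$, let $\zeta_e=\exp(2\pi i/e)$, and let $$X=\{t_0,\dots,t_{e-1},s_3,\dots,s_n\}\subset G(e,e,n),$$ where $t_i$ is the block diagonal matrix with blocks $\begin{pmatrix}0&\zeta_e^{-i}\\ \zeta_e^{i}&0\end{pmatrix}$ and $I_{n-2}$, and $s_j$ is the permutation matrix of the transposition $(j-1,j)$. Let $\ell(w)$ be the minimal length of a word over $X$ representing $w\in G(e,e,n)$, and write $w'\preceq w$ if $w=w'w''$ for some $w''\in G(e,e,n)$ with $\ell(w)=\ell(w')+\ell(w'')$. Let $$\lambda=\mathrm{diag}\big(\zeta_e^{-(n-1)},\zeta_e,\dots,\zeta_e\big)\in G(e,e,n),\qquad D_k=[1,\lambda^k]=\{w\in G(e,e,n) : 1\preceq w\preceq\lambda^k\}.$$ Let $M([1,\lambda^k])$ be the monoid generated by symbols $\underline{w}$, $w\in D_k$, subject to the relations $\underline{w}=\underline{w'}\,\underline{w''}$ whenever $w,w',w''\in D_k$, $w=w'w''$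 and $\ell(w)=\ell(w')+\ell(w'')$, together with $\underline{1}=1$. Then $(M([1,\lambda^k]),\underline{\lambda^k})$ is a Garside monoid with simples $\underline{D_k}=\{\underline{w} : w\in D_k\}$, a copy of $D_k$. That is, writing $M=M([1,\lambda^k])$ and $\Delta=\underline{\lambda^k}$: 1. $M$ is left and right cancellative; 2. there is a map $\mu:M\to\mathbb{N}$ with $\mu(fg)\ge\mu(f)+\mu(g)$ for all $f,g\in M$ and $\mu(g)\ne 0$ for $g\ne 1$; 3. any two elements of $M$ have a gcd and an lcm for left divisibility, and a gcd and an lcm for right divisibility; 4. the set of left divisors of $\Delta$ in $M$ equals the set of its right divisors, is finite, and generates $M$; 5. the map $D_k\to M$, $w\mapsto\underline{w}$, is injective, and its image is the set of divisors of $\Delta$ (the simples). Moreover, the group of fractions of $M$ exists: there are a group $\Gamma$ and an injective monoid homomorphism $\iota:M\to\Gamma$ such that every element of $\Gamma$ is of the form $\iota(f)\iota(g)^{-1}$ and also of the form $\iota(g')^{-1}\iota(f')$, with $f,g,f',g'\in M$. -/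

import Mathlib

/-! ### Garside monoids

Left divisibility `f ≼ g` is Mathlib's `f ∣ g` (in a monoid: `∃ c, g = f * c`), and right
divisibility is Mathlib's `RightDvd f g` (`∃ c, g = c * f`). -/

/-- `d` is a greatest common divisor of `f` and `g` for the divisibility relation `r`. -/
def IsGcdFor {M : Type*} (r : M → M → Prop) (f g d : M) : Prop :=
  r d f ∧ r d g ∧ ∀ c, r c f → r c g → r c d

/-- `m` is a least common multiple of `f` and `g` for the divisibility relation `r`. -/
def IsLcmFor {M : Type*} (r : M → M → Prop) (f g m : M) : Prop :=
  r f m ∧ r g m ∧ ∀ c, r f c → r g c → r m c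

/-- `(M, Δ)` is a Garside monoid. -/
structure IsGarsideMonoid (M : Type*) [Monoid M] (Δ : M) : Prop where
  left_cancel : ∀ f g h : M, f * g = f * h → g = h
  right_cancel : ∀ f g h : M, g * f = h * f → g = h
  exists_weight : ∃ wt : M → ℕ,
    (∀ f g, wt f + wt g ≤ wt (f * g)) ∧ ∀ g, g ≠ 1 → wt g ≠ 0
  exists_gcd : ∀ f g : M, ∃ d, IsGcdFor (fun a b => a ∣ b) f g d
  exists_lcm : ∀ f g : M, ∃ m, IsLcmFor (fun a b => a ∣ b) f g m
  exists_right_gcd : ∀ f g : M, ∃ d, IsGcdFor RightDvd f g d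
  exists_right_lcm : ∀ f g : M, ∃ m, IsLcmFor RightDvd f g m
  divisors_eq : {f : M | f ∣ Δ} = {f : M | RightDvd f Δ}
  divisors_generate : Submonoid.closure {f : M | f ∣ Δ} = ⊤
  divisors_finite : {f : M | f ∣ Δ}.Finite

/-- The simples of `(M, Δ)`: the divisors of `Δ`. -/
def garsideSimples {M : Type*} [Monoid M] (Δ : M) : Set M := {f | f ∣ Δ}

/-- `ι : M → Γ` exhibits the group `Γ` as a group of fractions of `M`: it is an embedding, and
every element of `Γ` is both a right fraction and a left fraction of elements of `M`. -/
structure IsGroupOfFractions {M Γ : Type*} [Monoid M] [Group Γ] (ι : M →* Γ) : Prop where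
  injective : Function.Injective ι
  right_fraction : ∀ x : Γ, ∃ f g : M, x = ι f * (ι g)⁻¹
  left_fraction : ∀ x : Γ, ∃ f g : M, x = (ι g)⁻¹ * ι f

/-! ### Intervals in a group and interval monoids -/

section Interval

variable {G : Type*} [Group G]

/-- The length of `g` over `S`: the minimal length of a word over `S` representing `g`. -/
noncomputable def wordLength (S : Set G) (g : G) : ℕ :=
  sInf {r : ℕ | ∃ l : List G, (∀ x ∈ l, x ∈ S) ∧ l.prod = g ∧ l.length = r}

/-- `g ≼ f`: `g` is a divisor of `f` with respect to the length over `S`. -/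
def LengthDvd (S : Set G) (g f : G) : Prop :=
  ∃ h : G, f = g * h ∧ wordLength S f = wordLength S g + wordLength S h

/-- The interval `[1, w]`. -/
def lengthInterval (S : Set G) (w : G) : Set G :=
  {f | LengthDvd S 1 f ∧ LengthDvd S f w}

theorem wordLength_one (S : Set G) : wordLength S 1 = 0 :=
  Nat.sInf_eq_zero.2 (Or.inl ⟨[], by simp, by simp, by simp⟩)

theorem self_mem_lengthInterval (S : Set G) (w : G) : w ∈ lengthInterval S w :=
  ⟨⟨w, by simp, by simp [wordLength_one]⟩, ⟨1, by simp, by simp [wordLength_one]⟩⟩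

/-- The defining relations of the interval monoid. The copy of `1` is identified with the empty
word, so that `1` is the unit of the monoid. -/
inductive IntervalRel (S : Set G) (w : G) :
    FreeMonoid (lengthInterval S w) → FreeMonoid (lengthInterval S w) → Prop
  | mul (f g h : lengthInterval S w) (hmul : (f : G) * (g : G) = h)
      (hlen : wordLength S (f : G) + wordLength S (g : G) = wordLength S (h : G)) :
      IntervalRel S w (FreeMonoid.of f * FreeMonoid.of g) (FreeMonoid.of h)
  | one (u : lengthInterval S w) (hu : (u : G) = 1) :
      IntervalRel S w (FreeMonoid.of u) 1

/-- The interval monoid `M([1, w])`. -/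
abbrev IntervalMonoid (S : Set G) (w : G) : Type _ := PresentedMonoid (IntervalRel S w)

/-- The canonical map `f ↦ f̲` from the interval `[1, w]` to `M([1, w])`. -/
def intervalCopy (S : Set G) (w : G) (f : lengthInterval S w) : IntervalMonoid S w :=
  PresentedMonoid.of (IntervalRel S w) f

/-- The element `w̲` of `M([1, w])`. -/
def intervalTop (S : Set G) (w : G) : IntervalMonoid S w :=
  intervalCopy S w ⟨w, self_mem_lengthInterval S w⟩

end Interval

/-! ### The complex reflection group `G(e,e,n)` -/

/-- `A` is the monomial matrix whose unique nonzero entry in row `i` is `a i`, in column `σ i`. -/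
def IsMonomialWith {n : ℕ} (A : Matrix (Fin n) (Fin n) ℂ) (σ : Equiv.Perm (Fin n))
    (a : Fin n → ℂ) : Prop :=
  ∀ i j, A i j = if σ i = j then a i else 0

/-- `A` is a monomial matrix whose nonzero entries are `e`-th roots of unity with product `1`. -/
def IsGeen (e : ℕ) {n : ℕ} (A : Matrix (Fin n) (Fin n) ℂ) : Prop :=
  ∃ (σ : Equiv.Perm (Fin n)) (a : Fin n → ℂ),
    IsMonomialWith A σ a ∧ (∀ i, a i ^ e = 1) ∧ ∏ i, a i = 1

theorem IsMonomialWith.mul {n : ℕ} {A B : Matrix (Fin n) (Fin n) ℂ} {σ τ : Equiv.Perm (Fin n)}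
    {a b : Fin n → ℂ} (hA : IsMonomialWith A σ a) (hB : IsMonomialWith B τ b) :
    IsMonomialWith (A * B) (τ * σ) (fun i => a i * b (σ i)) := by
  intro i j
  simp [Matrix.mul_apply, hA i, hB (σ i) j]
  rfl

theorem IsGeen.one (e n : ℕ) : IsGeen e (1 : Matrix (Fin n) (Fin n) ℂ) :=
  ⟨1, fun _ => 1, fun i j => by simp [Matrix.one_apply]; rfl, by simp, by simp⟩

theorem IsGeen.mul {e n : ℕ} {A B : Matrix (Fin n) (Fin n) ℂ} (hA : IsGeen e A)
    (hB : IsGeen e B) : IsGeen e (A * B) := by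
  obtain ⟨σ, a, hσ, ha, ha1⟩ := hA
  obtain ⟨τ, b, hτ, hb, hb1⟩ := hB
  refine ⟨τ * σ, fun i => a i * b (σ i), hσ.mul hτ, fun i => by simp [mul_pow, ha, hb], ?_⟩
  rw [Finset.prod_mul_distrib, ha1, Equiv.prod_comp σ b, hb1, one_mul]

theorem IsGeen.inv {e n : ℕ} {g : GL (Fin n) ℂ} (hg : IsGeen e (g : Matrix (Fin n) (Fin n) ℂ)) :
    IsGeen e ((g⁻¹ : GL (Fin n) ℂ) : Matrix (Fin n) (Fin n) ℂ) := by
  obtain ⟨σ, a, hσ, ha, ha1⟩ := hg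
  have hne : ∀ i, a i ≠ 0 := fun i h0 => by
    have h := Finset.prod_eq_zero (Finset.mem_univ i) h0
    rw [ha1] at h
    exact one_ne_zero h
  set B : Matrix (Fin n) (Fin n) ℂ :=
    Matrix.of fun i j => if σ⁻¹ i = j then (a (σ⁻¹ i))⁻¹ else 0 with hBdef
  have hB : IsMonomialWith B σ⁻¹ (fun i => (a (σ⁻¹ i))⁻¹) := fun i j => by simp [hBdef]
  have hmul : (g : Matrix (Fin n) (Fin n) ℂ) * B = 1 := by
    ext i j
    rw [hσ.mul hB i j]
    simp [Matrix.one_apply, hne]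
  have hgB : ((g⁻¹ : GL (Fin n) ℂ) : Matrix (Fin n) (Fin n) ℂ) = B := by
    calc ((g⁻¹ : GL (Fin n) ℂ) : Matrix (Fin n) (Fin n) ℂ)
        = (g⁻¹ : GL (Fin n) ℂ) * ((g : Matrix (Fin n) (Fin n) ℂ) * B) := by rw [hmul, mul_one]
      _ = B := by rw [← mul_assoc, ← Units.val_mul, inv_mul_cancel, Units.val_one, one_mul]
  rw [hgB]
  refine ⟨σ⁻¹, _, hB, fun i => by simp [ha], ?_⟩
  rw [Equiv.prod_comp σ⁻¹ (fun i => (a i)⁻¹), Finset.prod_inv_distrib, ha1, inv_one]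

/-- The group `G(e,e,n)` of `n × n` monomial matrices whose nonzero entries are `e`-th roots of
unity with product `1`. -/
def Geen (e n : ℕ) : Subgroup (GL (Fin n) ℂ) where
  carrier := {g | IsGeen e (g : Matrix (Fin n) (Fin n) ℂ)}
  mul_mem' hg hh := by simpa using IsGeen.mul hg hh
  one_mem' := by simpa using IsGeen.one e n
  inv_mem' hg := IsGeen.inv hg

/-- `ζ_e = exp(2πi/e)`. -/
noncomputable def zetaRoot (e : ℕ) : ℂ := Complex.exp (2 * Real.pi * Complex.I / e)

theorem zetaRoot_pow (e : ℕ) : zetaRoot e ^ e = 1 := by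
  rcases Nat.eq_zero_or_pos e with rfl | h
  · simp
  · exact (Complex.isPrimitiveRoot_exp e h.ne').pow_eq_one

theorem zetaRoot_ne_zero (e : ℕ) : zetaRoot e ≠ 0 := Complex.exp_ne_zero _

/-- The matrix `t_i`: the block with rows `(0, ζ_e⁻ⁱ)`, `(ζ_eⁱ, 0)` on the first two coordinates,
the identity on the others (coordinates are numbered from `0` here). -/
noncomputable def tMatrix (e n i : ℕ) : Matrix (Fin n) (Fin n) ℂ :=
  Matrix.of fun r c =>
    if r.val = 0 ∧ c.val = 1 then (zetaRoot e)⁻¹ ^ i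
    else if r.val = 1 ∧ c.val = 0 then zetaRoot e ^ i
    else if r = c ∧ 2 ≤ r.val then 1 else 0

/-- The matrix `s_j`, `3 ≤ j ≤ n`: the transposition of the `(j-1)`-st and `j`-th coordinates,
which are `j - 2` and `j - 1` when numbered from `0`. -/
def sMatrix (n j : ℕ) : Matrix (Fin n) (Fin n) ℂ :=
  Matrix.of fun r c =>
    if r.val + 2 = j ∧ c.val + 1 = j then 1
    else if r.val + 1 = j ∧ c.val + 2 = j then 1
    else if r = c ∧ r.val + 2 ≠ j ∧ r.val + 1 ≠ j then 1 else 0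

/-- The Corran–Picantin generators `X = {t_0, …, t_{e-1}, s_3, …, s_n}` of `G(e,e,n)`. -/
def corranPicantinGens (e n : ℕ) : Set (Geen e n) :=
  {g | (∃ i, i < e ∧ ((g : GL (Fin n) ℂ) : Matrix (Fin n) (Fin n) ℂ) = tMatrix e n i) ∨
    ∃ j, 3 ≤ j ∧ j ≤ n ∧ ((g : GL (Fin n) ℂ) : Matrix (Fin n) (Fin n) ℂ) = sMatrix n j}

/-- The diagonal entries `(ζ_e⁻¹)ⁿ⁻¹, ζ_e, …, ζ_e` of `λ`. -/
noncomputable def lamEntry (e n : ℕ) (i : Fin n) : ℂ :=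
  if i.val = 0 then (zetaRoot e)⁻¹ ^ (n - 1) else zetaRoot e

theorem prod_lamEntry (e n : ℕ) : ∏ i, lamEntry e n i = 1 := by
  cases n with
  | zero => simp
  | succ m =>
    rw [Fin.prod_univ_succ]
    simp [lamEntry, zetaRoot_ne_zero e]

theorem lamEntry_pow (e n : ℕ) (i : Fin n) : lamEntry e n i ^ e = 1 := by
  unfold lamEntry
  split_ifs
  · rw [← pow_mul, mul_comm, pow_mul, inv_pow, zetaRoot_pow, inv_one, one_pow]
  · exact zetaRoot_pow e

/-- The element `λ = diag((ζ_e⁻¹)ⁿ⁻¹, ζ_e, …, ζ_e)` of `G(e,e,n)`. -/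
noncomputable def lam (e n : ℕ) : Geen e n :=
  ⟨Matrix.GeneralLinearGroup.mkOfDetNeZero (Matrix.diagonal (lamEntry e n))
      (by rw [Matrix.det_diagonal, prod_lamEntry]; exact one_ne_zero),
    ⟨1, lamEntry e n, fun i j => by
        simp [Matrix.GeneralLinearGroup.mkOfDetNeZero, Matrix.diagonal_apply]; rfl,
      lamEntry_pow e n, prod_lamEntry e n⟩⟩

/-!
Let `w` be an element of a group `G` generated by `S` whose left divisors for the word length are
also its right divisors, and suppose that any two elements of `[1, w]` have a join. For simples `f`
and `t`, the head of the formal product `f t` is the greatest `f * d` in `[1, w]` with `d`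
dividing `t`. Splitting off heads makes the interval monoid act on pairs of a simple and a monoid
element, and this action computes the greatest simple divisor of an element. Left cancellation and
left lcms follow. As `w` is balanced, conjugation by `w` preserves `[1, w]`, so `Δ` is
quasi-central; this transfers the results to the right and gives common multiples, hence fractions.

In `G(e,e,n)` the length is a sum over the pairs of rows `j < i`: an inversion contributes `1`,
and any other pair contributes `0` or `2` according to whether the entry of row `i` is `1`. Since
`λ ^ k` is scalar away from its first entry, it is balanced. All its pairs contribute `2`, and
additivity of the length forces, for `x ≼ λ ^ k` and a non-inverted pair `j < i`, the entry of row
`i` of `x` to be `1` or `ζ_e ^ k`. Therefore distinct `t_i` and `t_j` have the join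
`t_i * t_{i-k} = t_j * t_{j-k}`. The other pairs of generators commute or satisfy a braid relation,
and joins of generators yield all joins.
-/

/-! ### Divisibility and quasi-central elements -/

section GcdFromLcm

variable {M : Type*} {r : M → M → Prop} {f g : M}

-- A common divisor of minimal rank absorbs every other one through their least common multiple.
theorem exists_isGcdFor_of_exists_isLcmFor (rank : M → ℕ)
    (eq_of_rank_le : ∀ c m, r c m → r m f → rank c ≤ rank m → c = m)
    (exists_common : ∃ c, r c f ∧ r c g) (exists_lcm : ∀ c d, ∃ m, IsLcmFor r c d m) :
    ∃ d, IsGcdFor r f g d := by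
  obtain ⟨d, ⟨hdf, hdg⟩, hmin⟩ :=
    exists_minimalFor_of_wellFoundedLT (fun c => r c f ∧ r c g) rank exists_common
  refine ⟨d, hdf, hdg, fun c hcf hcg => ?_⟩
  obtain ⟨m, hcm, hdm, hm⟩ := exists_lcm c d
  have hmf : r m f := hm f hcf hdf
  have hmg : r m g := hm g hcg hdg
  have hrank : rank d ≤ rank m := (le_total _ _).elim id fun h => hmin ⟨hmf, hmg⟩ h
  rwa [eq_of_rank_le d m hdm hmf hrank]

end GcdFromLcm

/-- `Δ` is quasi-central: passing `Δ` from right to left acts on the monoid by an automorphism. -/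
def IsQuasiCentral {M : Type*} [Monoid M] (Δ : M) : Prop :=
  ∃ φ : M ≃* M, ∀ m, m * Δ = Δ * φ m

namespace IsQuasiCentral

variable {M : Type*} [Monoid M] {Δ : M}

theorem one : IsQuasiCentral (1 : M) := ⟨MulEquiv.refl M, fun m => by simp⟩

theorem mul {Δ' : M} (h : IsQuasiCentral Δ) (h' : IsQuasiCentral Δ') :
    IsQuasiCentral (Δ * Δ') := by
  obtain ⟨φ, hφ⟩ := h
  obtain ⟨ψ, hψ⟩ := h'
  exact ⟨φ.trans ψ, fun m => by
    rw [← mul_assoc, hφ, mul_assoc, hψ, ← mul_assoc, MulEquiv.trans_apply]⟩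

theorem pow (h : IsQuasiCentral Δ) (N : ℕ) : IsQuasiCentral (Δ ^ N) := by
  induction N with
  | zero => simpa using one
  | succ N ih => simpa [pow_succ] using ih.mul h

theorem dvd_iff_rightDvd [IsLeftCancelMul M] (h : IsQuasiCentral Δ) {m : M} :
    m ∣ Δ ↔ RightDvd m Δ := by
  obtain ⟨φ, hφ⟩ := h
  constructor
  · rintro ⟨x, hx⟩
    have hΔ : φ Δ = Δ := (mul_left_cancel (hφ Δ)).symm
    have hxm : φ Δ = x * φ m := by
      rw [hΔ]
      exact mul_left_cancel (a := m) (by rw [hφ, ← mul_assoc, ← hx])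
    exact ⟨φ.symm x, φ.injective (by simpa using hxm)⟩
  · rintro ⟨x, hx⟩
    exact ⟨φ x, mul_left_cancel (a := x) (by rw [hφ, ← mul_assoc, ← hx])⟩

theorem exists_dvd_pow (h : IsQuasiCentral Δ) (hgen : Submonoid.closure {f : M | f ∣ Δ} = ⊤)
    (m : M) : ∃ N, m ∣ Δ ^ N := by
  induction (hgen ▸ Submonoid.mem_top m : m ∈ Submonoid.closure {f : M | f ∣ Δ}) using
    Submonoid.closure_induction with
  | mem f hf => exact ⟨1, by simpa using hf⟩
  | one => exact ⟨0, one_dvd _⟩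
  | mul f g _ _ hf hg =>
    obtain ⟨a, x, hx⟩ := hf
    obtain ⟨b, y, hy⟩ := hg
    obtain ⟨φ, hφ⟩ := h.pow b
    refine ⟨a + b, y * φ x, ?_⟩
    calc Δ ^ (a + b) = f * (x * Δ ^ b) := by rw [pow_add, hx, mul_assoc]
      _ = f * (g * y * φ x) := by rw [hφ, ← hy]
      _ = f * g * (y * φ x) := by simp only [mul_assoc]

theorem exists_common_rightDvd_pow [IsLeftCancelMul M] (h : IsQuasiCentral Δ)
    (hgen : Submonoid.closure {f : M | f ∣ Δ} = ⊤) (f g : M) :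
    ∃ N, RightDvd f (Δ ^ N) ∧ RightDvd g (Δ ^ N) := by
  obtain ⟨N, hN⟩ := h.exists_dvd_pow hgen (f * g)
  refine ⟨N, (h.pow N).dvd_iff_rightDvd.1 ((dvd_mul_right f g).trans hN), ?_⟩
  obtain ⟨x, hx⟩ := (h.pow N).dvd_iff_rightDvd.1 hN
  exact ⟨x * f, by rw [hx, mul_assoc]⟩

theorem isRightCancelMul (h : IsQuasiCentral Δ) [IsLeftCancelMul M]
    (hgen : Submonoid.closure {f : M | f ∣ Δ} = ⊤) : IsRightCancelMul M := by
  refine ⟨fun f g k hgk => ?_⟩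
  obtain ⟨N, x, hx⟩ := h.exists_dvd_pow hgen f
  obtain ⟨φ, hφ⟩ := h.pow N
  refine φ.injective (mul_left_cancel (a := Δ ^ N) ?_)
  rw [← hφ, ← hφ, hx, ← mul_assoc, ← mul_assoc]
  exact congrArg (· * x) hgk

-- If `Δ ^ N = f' * f = g' * g`, the right gcd of `f` and `g` is the complement in `Δ ^ N` of the
-- left lcm of `f'` and `g'`.
theorem exists_right_gcd [IsLeftCancelMul M] (h : IsQuasiCentral Δ)
    (hgen : Submonoid.closure {f : M | f ∣ Δ} = ⊤)
    (exists_lcm : ∀ f g : M, ∃ m, IsLcmFor (fun a b => a ∣ b) f g m) (f g : M) :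
    ∃ d, IsGcdFor RightDvd f g d := by
  have := h.isRightCancelMul hgen
  obtain ⟨N, ⟨f', hf⟩, ⟨g', hg⟩⟩ := h.exists_common_rightDvd_pow hgen f g
  obtain ⟨m, ⟨a, hfa⟩, ⟨b, hgb⟩, hm⟩ := exists_lcm f' g'
  obtain ⟨d, hd⟩ : m ∣ Δ ^ N := hm _ ⟨f, hf⟩ ⟨g, hg⟩
  refine ⟨d, ⟨a, ?_⟩, ⟨b, ?_⟩, ?_⟩
  · exact mul_left_cancel (a := f') (by rw [← hf, hd, hfa, mul_assoc])
  · exact mul_left_cancel (a := g') (by rw [← hg, hd, hgb, mul_assoc])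
  · rintro c ⟨x, hx⟩ ⟨y, hy⟩
    have hxy : f' * x = g' * y :=
      mul_right_cancel (b := c) (by rw [mul_assoc, ← hx, mul_assoc, ← hy, ← hf, hg])
    obtain ⟨z, hz⟩ := hm (f' * x) ⟨x, rfl⟩ ⟨y, hxy⟩
    exact ⟨z, mul_left_cancel (a := m) (by rw [← hd, ← mul_assoc, ← hz, mul_assoc, ← hx, hf])⟩

theorem isGarsideMonoid [IsLeftCancelMul M] (h : IsQuasiCentral Δ) {wt : M → ℕ}
    (wt_mul : ∀ f g, wt f + wt g ≤ wt (f * g)) (wt_ne_zero : ∀ g, g ≠ 1 → wt g ≠ 0)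
    (exists_lcm : ∀ f g : M, ∃ m, IsLcmFor (fun a b => a ∣ b) f g m)
    (divisors_generate : Submonoid.closure {f : M | f ∣ Δ} = ⊤)
    (divisors_finite : {f : M | f ∣ Δ}.Finite) : IsGarsideMonoid M Δ := by
  have exists_right_gcd := h.exists_right_gcd divisors_generate exists_lcm
  have := h.isRightCancelMul divisors_generate
  have eq_one_of_wt_eq_zero (x : M) (hx : wt x = 0) : x = 1 :=
    by_contra fun h1 => wt_ne_zero x h1 hx
  refine
    { left_cancel := fun f g k => mul_left_cancel
      right_cancel := fun f g k => mul_right_cancel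
      exists_weight := ⟨wt, wt_mul, wt_ne_zero⟩
      exists_gcd := fun f g => ?_
      exists_lcm := exists_lcm
      exists_right_gcd := exists_right_gcd
      exists_right_lcm := fun f g => ?_
      divisors_eq := Set.ext fun m => h.dvd_iff_rightDvd
      divisors_generate := divisors_generate
      divisors_finite := divisors_finite }
  · refine exists_isGcdFor_of_exists_isLcmFor (fun c => wt f - wt c) ?_
      ⟨1, one_dvd f, one_dvd g⟩ exists_lcm
    rintro c _ ⟨x, rfl⟩ ⟨y, rfl⟩ hle
    have hx := wt_mul c x
    have hy := wt_mul (c * x) y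
    rw [eq_one_of_wt_eq_zero x (by omega), mul_one]
  · obtain ⟨N, hf, hg⟩ := h.exists_common_rightDvd_pow divisors_generate f g
    refine exists_isGcdFor_of_exists_isLcmFor (r := fun a b => RightDvd b a) wt ?_
      ⟨Δ ^ N, hf, hg⟩ exists_right_gcd
    rintro _ m ⟨x, rfl⟩ - hle
    have hx := wt_mul x m
    rw [eq_one_of_wt_eq_zero x (by omega), one_mul]

end IsQuasiCentral

/-! ### Groups of fractions -/

section Fractions

open OreLocalization

variable {M : Type*} [Monoid M]

theorem numeratorHom_mul_oreDiv [OreSet (⊤ : Submonoid M)] (r : M) (s : (⊤ : Submonoid M)) :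
    numeratorHom (S := (⊤ : Submonoid M)) (s : M) * (r /ₒ s) = numeratorHom r := by
  rw [numeratorHom_apply, OreLocalization.mul_cancel, numeratorHom_apply]

theorem isUnit_oreLocalization_top [OreSet (⊤ : Submonoid M)]
    (z : OreLocalization (⊤ : Submonoid M) M) : IsUnit z := by
  have isUnit_numeratorHom (m : M) : IsUnit (numeratorHom (S := (⊤ : Submonoid M)) m) :=
    numerator_isUnit (S := (⊤ : Submonoid M)) ⟨m, trivial⟩
  induction z using OreLocalization.ind with
  | _ r s =>
    have hr := isUnit_numeratorHom r
    rwa [← numeratorHom_mul_oreDiv r s, ← (isUnit_numeratorHom s).unit_spec,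
      Units.isUnit_units_mul] at hr

theorem numeratorHom_top_injective [IsLeftCancelMul M] [OreSet (⊤ : Submonoid M)] :
    Function.Injective (numeratorHom : M →* OreLocalization (⊤ : Submonoid M) M) := by
  intro a b hab
  rw [numeratorHom_apply, numeratorHom_apply, oreDiv_eq_iff] at hab
  obtain ⟨u, v, hba, huv⟩ := hab
  have huv : (u : M) = v := by simpa using huv
  exact (mul_left_cancel (hba.trans (congrArg (· * a) huv.symm))).symm

theorem exists_isGroupOfFractions.{u} {M : Type u} [CancelMonoid M]
    (left_multiple : ∀ f g : M, ∃ x y, x * f = y * g)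
    (right_multiple : ∀ f g : M, ∃ x y, f * x = g * y) :
    ∃ (Γ : Type u) (_ : Group Γ) (ι : M →* Γ), IsGroupOfFractions ι := by
  choose x y hxy using left_multiple
  let _ : OreSet (⊤ : Submonoid M) :=
    { ore_right_cancel := fun r₁ r₂ s h => ⟨1, by rw [mul_right_cancel h]⟩
      oreNum := fun r s => y r s
      oreDenom := fun r s => ⟨x r s, trivial⟩
      ore_eq := fun r s => hxy r s }
  let _ : Group (OreLocalization (⊤ : Submonoid M) M) := groupOfIsUnit isUnit_oreLocalization_top
  have left_fraction (z : OreLocalization (⊤ : Submonoid M) M) :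
      ∃ f g : M, z = (numeratorHom g)⁻¹ * numeratorHom f := by
    induction z using OreLocalization.ind with
    | _ r s => exact ⟨r, s, eq_inv_mul_of_mul_eq (numeratorHom_mul_oreDiv r s)⟩
  refine ⟨OreLocalization (⊤ : Submonoid M) M, inferInstance, numeratorHom,
    numeratorHom_top_injective, fun z => ?_, left_fraction⟩
  obtain ⟨f, g, rfl⟩ := left_fraction z
  obtain ⟨c, d, hcd⟩ := right_multiple f g
  refine ⟨d, c, ?_⟩
  rw [eq_mul_inv_iff_mul_eq, mul_assoc, inv_mul_eq_iff_eq_mul, ← map_mul, ← map_mul, hcd]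

theorem IsGarsideMonoid.exists_isGroupOfFractions.{u} {M : Type u} [Monoid M] {Δ : M}
    (h : IsGarsideMonoid M Δ) :
    ∃ (Γ : Type u) (_ : Group Γ) (ι : M →* Γ), IsGroupOfFractions ι := by
  let _ : CancelMonoid M :=
    { mul_left_cancel := fun f _ _ => h.left_cancel f _ _
      mul_right_cancel := fun f _ _ => h.right_cancel f _ _ }
  refine _root_.exists_isGroupOfFractions (fun f g => ?_) (fun f g => ?_)
  · obtain ⟨m, ⟨a, ha⟩, ⟨b, hb⟩, -⟩ := h.exists_right_lcm f g
    exact ⟨a, b, ha.symm.trans hb⟩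
  · obtain ⟨m, ⟨a, ha⟩, ⟨b, hb⟩, -⟩ := h.exists_lcm f g
    exact ⟨a, b, ha.symm.trans hb⟩

end Fractions

/-! ### Word length -/

section WordLength

variable {G : Type*} [Group G] {S : Set G}

theorem wordLength_prod_le {l : List G} (hl : ∀ x ∈ l, x ∈ S) :
    wordLength S l.prod ≤ l.length :=
  Nat.sInf_le ⟨l, hl, rfl, rfl⟩

theorem wordLength_le_one {s : G} (hs : s ∈ S) : wordLength S s ≤ 1 := by
  simpa using wordLength_prod_le (l := [s]) (by simpa using hs)

theorem exists_reduced_word (hS : Submonoid.closure S = ⊤) (g : G) :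
    ∃ l : List G, (∀ x ∈ l, x ∈ S) ∧ l.prod = g ∧ l.length = wordLength S g := by
  obtain ⟨l, hl, hg⟩ := Submonoid.exists_list_of_mem_closure (hS ▸ Submonoid.mem_top g)
  exact Nat.sInf_mem (s := {r | ∃ l : List G, (∀ x ∈ l, x ∈ S) ∧ l.prod = g ∧ l.length = r})
    ⟨_, l, hl, hg, rfl⟩

theorem wordLength_mul_le (hS : Submonoid.closure S = ⊤) (g h : G) :
    wordLength S (g * h) ≤ wordLength S g + wordLength S h := by
  obtain ⟨l, hl, rfl, hlen⟩ := exists_reduced_word hS g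
  obtain ⟨l', hl', rfl, hlen'⟩ := exists_reduced_word hS h
  rw [← hlen, ← hlen', ← List.length_append, ← List.prod_append]
  exact wordLength_prod_le fun x hx => (List.mem_append.1 hx).elim (hl x) (hl' x)

theorem wordLength_eq_zero_iff (hS : Submonoid.closure S = ⊤) {g : G} :
    wordLength S g = 0 ↔ g = 1 := by
  refine ⟨fun h => ?_, fun h => h ▸ wordLength_one S⟩
  obtain ⟨l, -, rfl, hlen⟩ := exists_reduced_word hS g
  rw [List.length_eq_zero_iff.1 (hlen.trans h), List.prod_nil]

theorem wordLength_inv (hS : Submonoid.closure S = ⊤) (hinv : ∀ s ∈ S, s⁻¹ ∈ S) (g : G) :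
    wordLength S g⁻¹ = wordLength S g := by
  have inv_le (h : G) : wordLength S h⁻¹ ≤ wordLength S h := by
    obtain ⟨l, hl, rfl, hlen⟩ := exists_reduced_word hS h
    rw [← hlen, List.prod_inv_reverse]
    refine (wordLength_prod_le fun x hx => ?_).trans_eq (by simp)
    obtain ⟨y, hy, rfl⟩ := List.mem_map.1 (List.mem_reverse.1 hx)
    exact hinv y (hl y hy)
  exact (inv_le g).antisymm (by simpa using inv_le g⁻¹)

theorem exists_word_of_descent {L : G → ℕ} (one : L 1 = 0)
    (descent : ∀ g, g ≠ 1 → ∃ s ∈ S, ∃ h, g = s * h ∧ L g = L h + 1) (g : G) :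
    ∃ l : List G, (∀ x ∈ l, x ∈ S) ∧ l.prod = g ∧ l.length = L g := by
  induction hL : L g using Nat.strong_induction_on generalizing g with
  | _ N ih =>
    subst hL
    by_cases hg : g = 1
    · exact ⟨[], by simp, hg.symm, by simp [hg, one]⟩
    · obtain ⟨s, hs, h, rfl, hlen⟩ := descent g hg
      obtain ⟨l, hl, rfl, hl'⟩ := ih (L h) (by omega) h rfl
      exact ⟨s :: l, by simpa using ⟨hs, hl⟩, List.prod_cons, by rw [List.length_cons, hl', hlen]⟩

theorem closure_eq_top_of_descent {L : G → ℕ} (one : L 1 = 0)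
    (descent : ∀ g, g ≠ 1 → ∃ s ∈ S, ∃ h, g = s * h ∧ L g = L h + 1) :
    Submonoid.closure S = ⊤ := by
  refine eq_top_iff.2 fun g _ => ?_
  obtain ⟨l, hl, rfl, -⟩ := exists_word_of_descent one descent g
  exact list_prod_mem fun x hx => Submonoid.subset_closure (hl x hx)

theorem wordLength_eq_of_descent {L : G → ℕ} (one : L 1 = 0)
    (descent : ∀ g, g ≠ 1 → ∃ s ∈ S, ∃ h, g = s * h ∧ L g = L h + 1)
    (mul_le : ∀ s ∈ S, ∀ g, L (s * g) ≤ L g + 1) (g : G) :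
    wordLength S g = L g := by
  refine le_antisymm ?_ ?_
  · obtain ⟨l, hl, rfl, hlen⟩ := exists_word_of_descent one descent g
    exact (wordLength_prod_le hl).trans_eq hlen
  · obtain ⟨l, hl, rfl, hlen⟩ :=
      exists_reduced_word (closure_eq_top_of_descent one descent) g
    rw [← hlen]
    clear hlen
    induction l with
    | nil => simp [one]
    | cons s l ih =>
      rw [List.prod_cons, List.length_cons]
      have := ih fun x hx => hl x (List.mem_cons_of_mem s hx)
      have := mul_le s (hl s List.mem_cons_self) l.prod
      omega

end WordLength

/-! ### Divisibility for the length -/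

section LengthDivisibility

variable {G : Type*} [Group G] {S : Set G} {w : G}

theorem lengthDvd_iff {g f : G} :
    LengthDvd S g f ↔ wordLength S f = wordLength S g + wordLength S (g⁻¹ * f) := by
  constructor
  · rintro ⟨h, rfl, hl⟩
    simpa using hl
  · exact fun h => ⟨g⁻¹ * f, by simp, h⟩

theorem LengthDvd.refl (g : G) : LengthDvd S g g := ⟨1, by simp, by simp [wordLength_one]⟩

theorem one_lengthDvd (g : G) : LengthDvd S 1 g := ⟨g, by simp, by simp [wordLength_one]⟩

theorem mem_lengthInterval {g : G} : g ∈ lengthInterval S w ↔ LengthDvd S g w :=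
  ⟨fun h => h.2, fun h => ⟨one_lengthDvd g, h⟩⟩

theorem one_mem_lengthInterval : (1 : G) ∈ lengthInterval S w :=
  mem_lengthInterval.2 (one_lengthDvd w)

namespace LengthDvd

variable {f g h q : G}

theorem wordLength_le (hfg : LengthDvd S f g) : wordLength S f ≤ wordLength S g := by
  have := lengthDvd_iff.1 hfg
  omega

theorem of_quotient (hfg : LengthDvd S f g) (hfh : LengthDvd S f h)
    (hq : LengthDvd S (f⁻¹ * g) (f⁻¹ * h)) : LengthDvd S g h := by
  rw [lengthDvd_iff] at *
  rw [show (f⁻¹ * g)⁻¹ * (f⁻¹ * h) = g⁻¹ * h by group] at hq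
  omega

theorem trans (hS : Submonoid.closure S = ⊤) (hfg : LengthDvd S f g)
    (hgh : LengthDvd S g h) : LengthDvd S f h := by
  rw [lengthDvd_iff] at *
  have hfgh := wordLength_mul_le hS (f⁻¹ * g) (g⁻¹ * h)
  have hfh := wordLength_mul_le hS f (f⁻¹ * h)
  simp only [mul_assoc, mul_inv_cancel_left] at hfgh hfh
  omega

theorem eq_of_wordLength_le (hS : Submonoid.closure S = ⊤) (hfg : LengthDvd S f g)
    (hle : wordLength S g ≤ wordLength S f) : f = g := by
  rw [lengthDvd_iff] at hfg
  exact inv_mul_eq_one.1 ((wordLength_eq_zero_iff hS).1 (by omega))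

theorem antisymm (hS : Submonoid.closure S = ⊤) (hfg : LengthDvd S f g)
    (hgf : LengthDvd S g f) : f = g :=
  hfg.eq_of_wordLength_le hS hgf.wordLength_le

theorem quotient (hS : Submonoid.closure S = ⊤) (hfg : LengthDvd S f g)
    (hgh : LengthDvd S g h) : LengthDvd S (f⁻¹ * g) (f⁻¹ * h) := by
  have hfh := hfg.trans hS hgh
  rw [lengthDvd_iff] at *
  rw [show (f⁻¹ * g)⁻¹ * (f⁻¹ * h) = g⁻¹ * h by group]
  omega

theorem self_mul (hS : Submonoid.closure S = ⊤) (hfh : LengthDvd S f h)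
    (hq : LengthDvd S q (f⁻¹ * h)) : LengthDvd S f (f * q) := by
  rw [lengthDvd_iff] at *
  have hfq := wordLength_mul_le hS f q
  have hfqh := wordLength_mul_le hS (f * q) (q⁻¹ * (f⁻¹ * h))
  rw [show f * q * (q⁻¹ * (f⁻¹ * h)) = h by group] at hfqh
  rw [inv_mul_cancel_left]
  omega

theorem mul_of_quotient (hS : Submonoid.closure S = ⊤) (hfh : LengthDvd S f h)
    (hq : LengthDvd S q (f⁻¹ * h)) : LengthDvd S (f * q) h :=
  (hfh.self_mul hS hq).of_quotient hfh (by rwa [inv_mul_cancel_left])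

end LengthDvd

theorem exists_generator_lengthDvd (hS : Submonoid.closure S = ⊤) {g : G} (hg : g ≠ 1) :
    ∃ s ∈ S, LengthDvd S s g ∧ wordLength S s = 1 := by
  obtain ⟨l, hl, rfl, hlen⟩ := exists_reduced_word hS g
  match l with
  | [] => exact absurd List.prod_nil hg
  | s :: l =>
    obtain ⟨hs, hl⟩ := List.forall_mem_cons.1 hl
    have hs1 := wordLength_le_one hs
    have hl1 := wordLength_prod_le hl
    have hsl := wordLength_mul_le hS s l.prod
    rw [List.prod_cons, List.length_cons] at hlen
    exact ⟨s, hs, ⟨l.prod, List.prod_cons, by rw [List.prod_cons]; omega⟩, by omega⟩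

theorem mem_lengthInterval_of_lengthDvd (hS : Submonoid.closure S = ⊤) {u v : G}
    (huv : LengthDvd S u v) (hv : v ∈ lengthInterval S w) : u ∈ lengthInterval S w :=
  mem_lengthInterval.2 (huv.trans hS (mem_lengthInterval.1 hv))

end LengthDivisibility

/-! ### Balanced intervals -/

section Balanced

variable {G : Type*} [Group G] {S : Set G} {w : G}

/-- `w` is balanced: its left divisors for the length over `S` are also its right divisors, the
latter being the `u` for which `w * u⁻¹` and `u` have lengths adding up to that of `w`. -/
def IsBalanced (S : Set G) (w : G) : Prop :=
  ∀ u, LengthDvd S u w ↔ wordLength S w = wordLength S (w * u⁻¹) + wordLength S u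

/-- Divisibility for the length, as an order relation on the interval `[1, w]`; its joins and
meets are expressed by `IsLcmFor` and `IsGcdFor`. -/
def IntervalDvd (u v : lengthInterval S w) : Prop := LengthDvd S (u : G) (v : G)

namespace IsBalanced

variable {u v f : G}

theorem inv_mul_top_mem (hw : IsBalanced S w) (hu : u ∈ lengthInterval S w) :
    u⁻¹ * w ∈ lengthInterval S w := by
  rw [mem_lengthInterval] at *
  rw [hw, show w * (u⁻¹ * w)⁻¹ = u by group]
  exact lengthDvd_iff.1 hu

theorem top_mul_inv_mem (hw : IsBalanced S w) (hu : u ∈ lengthInterval S w) :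
    w * u⁻¹ ∈ lengthInterval S w := by
  rw [mem_lengthInterval] at *
  rw [lengthDvd_iff, show (w * u⁻¹)⁻¹ * w = u by group]
  exact (hw u).1 hu

theorem inv_conj_mem (hw : IsBalanced S w) (hu : u ∈ lengthInterval S w) :
    w⁻¹ * u * w ∈ lengthInterval S w := by
  simpa [mul_assoc] using hw.inv_mul_top_mem (hw.inv_mul_top_mem hu)

theorem conj_mem (hw : IsBalanced S w) (hu : u ∈ lengthInterval S w) :
    w * u * w⁻¹ ∈ lengthInterval S w := by
  simpa [mul_assoc] using hw.top_mul_inv_mem (hw.top_mul_inv_mem hu)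

theorem wordLength_inv_conj (hw : IsBalanced S w) (hu : u ∈ lengthInterval S w) :
    wordLength S (w⁻¹ * u * w) = wordLength S u := by
  have hlen := lengthDvd_iff.1 (mem_lengthInterval.1 hu)
  have hlen' := lengthDvd_iff.1 (mem_lengthInterval.1 (hw.inv_mul_top_mem hu))
  rw [show (u⁻¹ * w)⁻¹ * w = w⁻¹ * u * w by group] at hlen'
  omega

theorem wordLength_conj (hw : IsBalanced S w) (hu : u ∈ lengthInterval S w) :
    wordLength S (w * u * w⁻¹) = wordLength S u := by
  rw [← hw.wordLength_inv_conj (hw.conj_mem hu)]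
  group

theorem inv_mul_mem (hw : IsBalanced S w) (hS : Submonoid.closure S = ⊤)
    (huv : LengthDvd S u v) (hv : v ∈ lengthInterval S w) : u⁻¹ * v ∈ lengthInterval S w :=
  mem_lengthInterval_of_lengthDvd hS (huv.quotient hS (mem_lengthInterval.1 hv))
    (hw.inv_mul_top_mem (mem_lengthInterval_of_lengthDvd hS huv hv))

theorem exists_join_of_quotient (hw : IsBalanced S w) (hS : Submonoid.closure S = ⊤)
    {u v : lengthInterval S w} (hfu : LengthDvd S f u) (hfv : LengthDvd S f v)
    (hj : ∃ j, IsLcmFor IntervalDvd (⟨f⁻¹ * u, hw.inv_mul_mem hS hfu u.2⟩ : lengthInterval S w)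
      ⟨f⁻¹ * v, hw.inv_mul_mem hS hfv v.2⟩ j) :
    ∃ j, IsLcmFor IntervalDvd u v j := by
  obtain ⟨j, huj, hvj, hj⟩ := hj
  have le_quotient {x : G} (hx : x ∈ lengthInterval S w) (hux : LengthDvd S u x)
      (hvx : LengthDvd S v x) : LengthDvd S j (f⁻¹ * x) :=
    hj ⟨f⁻¹ * x, hw.inv_mul_mem hS (hfu.trans hS hux) hx⟩ (hfu.quotient hS hux)
      (hfv.quotient hS hvx)
  have hfw : LengthDvd S f w := hfu.trans hS (mem_lengthInterval.1 u.2)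
  have hjw : LengthDvd S j (f⁻¹ * w) := le_quotient (self_mem_lengthInterval S w)
    (mem_lengthInterval.1 u.2) (mem_lengthInterval.1 v.2)
  have hfj : LengthDvd S f (f * j) := hfw.self_mul hS hjw
  refine ⟨⟨f * j, mem_lengthInterval.2 (hfw.mul_of_quotient hS hjw)⟩, ?_, ?_, ?_⟩
  · exact hfu.of_quotient hfj (by rw [inv_mul_cancel_left]; exact huj)
  · exact hfv.of_quotient hfj (by rw [inv_mul_cancel_left]; exact hvj)
  · exact fun x hux hvx => (hfu.trans hS hux).mul_of_quotient hS (le_quotient x.2 hux hvx)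

end IsBalanced

theorem exists_generator_mul_lengthDvd (hS : Submonoid.closure S = ⊤) {f u : G}
    (hfu : LengthDvd S f u) (hne : f ≠ u) :
    ∃ s ∈ S, LengthDvd S f (f * s) ∧ LengthDvd S (f * s) u ∧
      wordLength S (f * s) = wordLength S f + 1 := by
  obtain ⟨s, hs, hsu, hs1⟩ := exists_generator_lengthDvd hS (mt inv_mul_eq_one.1 hne)
  have hfs := hfu.self_mul hS hsu
  refine ⟨s, hs, hfs, hfu.mul_of_quotient hS hsu, ?_⟩
  rw [lengthDvd_iff.1 hfs, inv_mul_cancel_left, hs1]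

-- Induction on the colength of a common divisor `f` of `u` and `v`: with generators `s`, `t`
-- such that `f * s ≼ u` and `f * t ≼ v`, the join of `u` and `v` is obtained by joining first `u`
-- and then `v` to the join of `f * s` and `f * t`.
theorem IsBalanced.exists_join_of_generators (hw : IsBalanced S w)
    (hS : Submonoid.closure S = ⊤)
    (hjoin : ∀ s t : lengthInterval S w, (s : G) ∈ S → (t : G) ∈ S →
      ∃ j, IsLcmFor IntervalDvd s t j) (u v : lengthInterval S w) :
    ∃ j, IsLcmFor IntervalDvd u v j := by
  suffices key : ∀ (N : ℕ) (f : G) (u v : lengthInterval S w), LengthDvd S f u →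
      LengthDvd S f v → wordLength S w ≤ wordLength S f + N → ∃ j, IsLcmFor IntervalDvd u v j from
    key _ 1 u v (one_lengthDvd _) (one_lengthDvd _) (Nat.le_add_left _ _)
  intro N
  induction N with
  | zero =>
    intro f u v hfu hfv hN
    have huw := mem_lengthInterval.1 u.2
    obtain rfl : f = u := hfu.eq_of_wordLength_le hS (huw.wordLength_le.trans hN)
    exact ⟨v, hfv, LengthDvd.refl _, fun x _ hvx => hvx⟩
  | succ N ih =>
    intro f u v hfu hfv hN
    obtain rfl | hne := eq_or_ne f u
    · exact ⟨v, hfv, LengthDvd.refl _, fun x _ hvx => hvx⟩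
    obtain rfl | hne' := eq_or_ne f v
    · exact ⟨u, LengthDvd.refl _, hfu, fun x hux _ => hux⟩
    obtain ⟨s, hs, hfs, hsu, hlens⟩ := exists_generator_mul_lengthDvd hS hfu hne
    obtain ⟨t, ht, hft, htv, hlent⟩ := exists_generator_mul_lengthDvd hS hfv hne'
    let fs : lengthInterval S w := ⟨f * s, mem_lengthInterval_of_lengthDvd hS hsu u.2⟩
    let ft : lengthInterval S w := ⟨f * t, mem_lengthInterval_of_lengthDvd hS htv v.2⟩
    obtain ⟨p, hsp, htp, hp⟩ : ∃ p, IsLcmFor IntervalDvd fs ft p :=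
      hw.exists_join_of_quotient hS hfs hft
        (hjoin _ _ (by simpa [fs] using hs) (by simpa [ft] using ht))
    obtain ⟨q, huq, hpq, hq⟩ := ih (f * s) u p hsu hsp (by omega)
    obtain ⟨j, hqj, hvj, hj⟩ := ih (f * t) q v (htp.trans hS hpq) htv (by omega)
    refine ⟨j, huq.trans hS hqj, hvj, fun x hux hvx => hj x (hq x hux ?_) hvx⟩
    exact hp x (hsu.trans hS hux) (htv.trans hS hvx)

theorem exists_join_of_mul_eq (hS : Submonoid.closure S = ⊤) {s t : lengthInterval S w}
    {a b : G} (hab : (s : G) * a = t * b)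
    (hlen : wordLength S (t : G) + wordLength S b ≤ wordLength S (s : G) + wordLength S a)
    (hle : ∀ x ∈ lengthInterval S w, LengthDvd S s x → LengthDvd S t x →
      LengthDvd S a ((s : G)⁻¹ * x)) :
    ∃ j, IsLcmFor IntervalDvd s t j := by
  have hsw := mem_lengthInterval.1 s.2
  have haw := hle w (self_mem_lengthInterval S w) hsw (mem_lengthInterval.1 t.2)
  have hsa := hsw.self_mul hS haw
  refine ⟨⟨s * a, mem_lengthInterval.2 (hsw.mul_of_quotient hS haw)⟩, hsa, ⟨b, hab, ?_⟩, ?_⟩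
  · have hsa' := lengthDvd_iff.1 hsa
    have htb := wordLength_mul_le hS (t : G) b
    rw [inv_mul_cancel_left] at hsa'
    rw [← hab] at htb
    change wordLength S (s * a : G) = _
    omega
  · exact fun x hsx htx => hsx.mul_of_quotient hS (hle x x.2 hsx htx)

end Balanced

/-! ### Interval monoids -/

section IntervalMonoid

variable {G : Type*} [Group G] {S : Set G} {w : G}

/-- The canonical projection of the interval monoid to the group. -/
def intervalProj (S : Set G) (w : G) : IntervalMonoid S w →* G :=
  PresentedMonoid.lift (rels := IntervalRel S w) (fun f : lengthInterval S w => (f : G)) (by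
    rintro _ _ (⟨f, g, h, hmul, -⟩ | ⟨u, hu⟩)
    · simpa using hmul
    · simpa using hu)

theorem intervalCopy_injective (S : Set G) (w : G) : Function.Injective (intervalCopy S w) :=
  fun _ _ h => Subtype.ext (congrArg (intervalProj S w) h)

/-- The homomorphism to `ℕ` extending the length on the interval. -/
noncomputable def intervalWeight (S : Set G) (w : G) :
    IntervalMonoid S w →* Multiplicative ℕ :=
  PresentedMonoid.lift (rels := IntervalRel S w)
    (fun f : lengthInterval S w => Multiplicative.ofAdd (wordLength S (f : G))) (by
    rintro _ _ (⟨f, g, h, -, hlen⟩ | ⟨u, hu⟩)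
    · simp [← ofAdd_add, hlen]
    · simp [hu, wordLength_one])

open Classical in
/-- The copy of `g` in the interval monoid, extended by the junk value `1` to the group elements
outside the interval. -/
noncomputable def intervalSimple (S : Set G) (w g : G) : IntervalMonoid S w :=
  if h : g ∈ lengthInterval S w then intervalCopy S w ⟨g, h⟩ else 1

theorem intervalSimple_of_mem {g : G} (h : g ∈ lengthInterval S w) :
    intervalSimple S w g = intervalCopy S w ⟨g, h⟩ := dif_pos h

theorem intervalSimple_coe (g : lengthInterval S w) :
    intervalSimple S w g = intervalCopy S w g := intervalSimple_of_mem g.2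

theorem intervalSimple_one : intervalSimple S w 1 = 1 := by
  rw [intervalSimple_of_mem one_mem_lengthInterval]
  exact PresentedMonoid.mk_eq_mk_of_rel (IntervalRel.one _ rfl)

theorem intervalTop_eq_intervalSimple : intervalTop S w = intervalSimple S w w :=
  (intervalSimple_of_mem (self_mem_lengthInterval S w)).symm

theorem intervalSimple_mul {u v : G} (hu : u ∈ lengthInterval S w) (hv : v ∈ lengthInterval S w)
    (huv : u * v ∈ lengthInterval S w)
    (hlen : wordLength S u + wordLength S v = wordLength S (u * v)) :
    intervalSimple S w u * intervalSimple S w v = intervalSimple S w (u * v) := by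
  rw [intervalSimple_of_mem hu, intervalSimple_of_mem hv, intervalSimple_of_mem huv]
  exact PresentedMonoid.mk_eq_mk_of_rel (IntervalRel.mul _ _ _ rfl hlen)

theorem intervalMonoid_induction {P : IntervalMonoid S w → Prop} (one : P 1)
    (mul : ∀ (s : lengthInterval S w) (m), P m → P (intervalSimple S w s * m)) (m) : P m := by
  obtain ⟨U, rfl⟩ := PresentedMonoid.surjective_mk m
  induction U using FreeMonoid.inductionOn' with
  | one => simpa using one
  | of_mul s U ih =>
    rw [map_mul]
    have hmul := mul s _ ih
    rwa [intervalSimple_coe] at hmul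

theorem toAdd_intervalWeight_ne_zero (hS : Submonoid.closure S = ⊤) (m : IntervalMonoid S w)
    (hm : m ≠ 1) : (intervalWeight S w m).toAdd ≠ 0 := by
  induction m using intervalMonoid_induction with
  | one => exact absurd rfl hm
  | mul s m ih =>
    intro hzero
    have hweight : wordLength S (s : G) + (intervalWeight S w m).toAdd = 0 := by
      rwa [map_mul, toAdd_mul, intervalSimple_coe] at hzero
    have hs : (s : G) = 1 := (wordLength_eq_zero_iff hS).1 (by omega)
    refine ih (fun hm1 => hm ?_) (by omega)
    rw [hs, intervalSimple_one, hm1, one_mul]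

/-- The endomorphism of the interval monoid induced by an endomorphism of the group that preserves
the interval and the length on it. -/
noncomputable def intervalMap (φ : G →* G)
    (hmem : ∀ u ∈ lengthInterval S w, φ u ∈ lengthInterval S w)
    (hlen : ∀ u ∈ lengthInterval S w, wordLength S (φ u) = wordLength S u) :
    IntervalMonoid S w →* IntervalMonoid S w :=
  PresentedMonoid.lift (rels := IntervalRel S w)
    (fun u : lengthInterval S w => intervalSimple S w (φ u)) (by
    rintro _ _ (⟨f, g, h, hmul, hfg⟩ | ⟨u, hu⟩)
    · have hφ : φ f * φ g = φ h := by rw [← map_mul, hmul]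
      simp only [map_mul, FreeMonoid.lift_eval_of]
      rw [intervalSimple_mul (hmem f f.2) (hmem g g.2) (hφ ▸ hmem h h.2), hφ]
      rw [hφ, hlen f f.2, hlen g g.2, hlen h h.2, hfg]
    · simp [hu, intervalSimple_one])

theorem intervalMap_intervalSimple {φ : G →* G}
    {hmem : ∀ u ∈ lengthInterval S w, φ u ∈ lengthInterval S w}
    {hlen : ∀ u ∈ lengthInterval S w, wordLength S (φ u) = wordLength S u} {u : G}
    (hu : u ∈ lengthInterval S w) :
    intervalMap φ hmem hlen (intervalSimple S w u) = intervalSimple S w (φ u) := by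
  rw [intervalSimple_of_mem hu]
  rfl

theorem intervalMap_comp_intervalMap {φ ψ : G →* G} (hφψ : φ.comp ψ = MonoidHom.id G)
    {hmem : ∀ u ∈ lengthInterval S w, φ u ∈ lengthInterval S w}
    {hlen : ∀ u ∈ lengthInterval S w, wordLength S (φ u) = wordLength S u}
    {hmem' : ∀ u ∈ lengthInterval S w, ψ u ∈ lengthInterval S w}
    {hlen' : ∀ u ∈ lengthInterval S w, wordLength S (ψ u) = wordLength S u} :
    (intervalMap φ hmem hlen).comp (intervalMap ψ hmem' hlen') = MonoidHom.id _ := by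
  refine MonoidHom.ext fun m => ?_
  rw [MonoidHom.comp_apply]
  induction m using intervalMonoid_induction with
  | one => simp
  | mul s m ih =>
    have hs : φ (ψ s) = s := DFunLike.congr_fun hφψ (s : G)
    rw [map_mul, map_mul, ih, intervalMap_intervalSimple s.2,
      intervalMap_intervalSimple (hmem' s s.2), hs, MonoidHom.id_apply, MonoidHom.id_apply]

namespace IsBalanced

variable {x y z : G}

theorem intervalSimple_quotient_mul (hw : IsBalanced S w) (hS : Submonoid.closure S = ⊤)
    (hxy : LengthDvd S x y) (hyz : LengthDvd S y z) (hz : z ∈ lengthInterval S w) :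
    intervalSimple S w (x⁻¹ * y) * intervalSimple S w (y⁻¹ * z) =
      intervalSimple S w (x⁻¹ * z) := by
  have hxz := hxy.trans hS hyz
  have hprod : x⁻¹ * y * (y⁻¹ * z) = x⁻¹ * z := by group
  have hmem := hw.inv_mul_mem hS hxz hz
  rw [lengthDvd_iff] at hxz
  have hxy' := lengthDvd_iff.1 hxy
  have hyz' := lengthDvd_iff.1 hyz
  rw [← hprod, intervalSimple_mul
    (hw.inv_mul_mem hS hxy (mem_lengthInterval_of_lengthDvd hS hyz hz))
    (hw.inv_mul_mem hS hyz hz) (hprod ▸ hmem) (by rw [hprod]; omega)]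

theorem intervalSimple_mul_quotient (hw : IsBalanced S w) (hS : Submonoid.closure S = ⊤)
    (hyz : LengthDvd S y z) (hz : z ∈ lengthInterval S w) :
    intervalSimple S w y * intervalSimple S w (y⁻¹ * z) = intervalSimple S w z := by
  simpa using hw.intervalSimple_quotient_mul hS (one_lengthDvd y) hyz hz

-- Both `s * Δ` and `Δ * (w⁻¹ * s * w)` are the product of `s`, `s⁻¹ * w` and `w⁻¹ * s * w`.
theorem intervalSimple_mul_top (hw : IsBalanced S w) (hS : Submonoid.closure S = ⊤)
    (s : lengthInterval S w) :
    intervalSimple S w s * intervalSimple S w w =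
      intervalSimple S w w * intervalSimple S w (w⁻¹ * s * w) := by
  have hwmem := self_mem_lengthInterval S w
  have hs := hw.intervalSimple_mul_quotient hS (mem_lengthInterval.1 s.2) hwmem
  have hs' := hw.intervalSimple_mul_quotient hS
    (mem_lengthInterval.1 (hw.inv_mul_top_mem s.2)) hwmem
  rw [show ((s : G)⁻¹ * w)⁻¹ * w = w⁻¹ * s * w by group] at hs'
  calc intervalSimple S w s * intervalSimple S w w
      = intervalSimple S w s * intervalSimple S w ((s : G)⁻¹ * w) *
          intervalSimple S w (w⁻¹ * s * w) := by rw [mul_assoc, hs']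
    _ = intervalSimple S w w * intervalSimple S w (w⁻¹ * s * w) := by rw [hs]

theorem isQuasiCentral_intervalTop (hw : IsBalanced S w) (hS : Submonoid.closure S = ⊤) :
    IsQuasiCentral (intervalTop S w) := by
  let conj : G →* G := (MulAut.conj w).toMonoidHom
  let invConj : G →* G := (MulAut.conj w).symm.toMonoidHom
  let φ := intervalMap invConj (fun _ => hw.inv_conj_mem) (fun _ => hw.wordLength_inv_conj)
  let ψ := intervalMap conj (fun _ => hw.conj_mem) (fun _ => hw.wordLength_conj)
  have hψφ : ψ.comp φ = MonoidHom.id _ :=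
    intervalMap_comp_intervalMap (MonoidHom.ext (MulAut.conj w).apply_symm_apply)
  have hφψ : φ.comp ψ = MonoidHom.id _ :=
    intervalMap_comp_intervalMap (MonoidHom.ext (MulAut.conj w).symm_apply_apply)
  refine ⟨φ.toMulEquiv ψ hψφ hφψ, fun m => ?_⟩
  change m * _ = _ * φ m
  rw [intervalTop_eq_intervalSimple]
  induction m using intervalMonoid_induction with
  | one => simp
  | mul s m ih =>
    have hφs : φ (intervalSimple S w s) = intervalSimple S w (w⁻¹ * s * w) :=
      intervalMap_intervalSimple s.2
    rw [mul_assoc, ih, ← mul_assoc, hw.intervalSimple_mul_top hS, map_mul, hφs, mul_assoc]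

end IsBalanced

end IntervalMonoid

/-! ### Garside intervals -/

section GarsideInterval

variable {G : Type*} [Group G] {S : Set G} {w : G}

/-- The interval `[1, w]` for the length over the generating set `S` is a Garside interval: `w` is
balanced and any two elements of the interval have a join. -/
structure IsGarsideInterval (S : Set G) (w : G) : Prop where
  closure_eq_top : Submonoid.closure S = ⊤
  isBalanced : IsBalanced S w
  exists_join : ∀ u v : lengthInterval S w, ∃ j, IsLcmFor IntervalDvd u v j

/-- `j` is the head of the formal product of `f` and `t`: the greatest `f * d` in the interval
with `f ≼ f * d` and `d ≼ t`. -/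
def IsProdHead (f t j : lengthInterval S w) : Prop :=
  LengthDvd S (f : G) j ∧ LengthDvd S ((f : G)⁻¹ * j) t ∧
    ∀ i : lengthInterval S w, LengthDvd S (f : G) i → LengthDvd S ((f : G)⁻¹ * i) t →
      IntervalDvd i j

namespace IsProdHead

variable {f g h t i j : lengthInterval S w}

theorem unique (hS : Submonoid.closure S = ⊤) (hi : IsProdHead f t i) (hj : IsProdHead f t j) :
    i = j :=
  Subtype.ext ((hj.2.2 i hi.1 hi.2.1).antisymm hS (hi.2.2 j hj.1 hj.2.1))

theorem one_left (hf : (f : G) = 1) : IsProdHead f t t := by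
  refine ⟨hf ▸ one_lengthDvd _, by simpa [hf] using LengthDvd.refl (t : G), fun i _ hi => ?_⟩
  simpa [hf, IntervalDvd] using hi

theorem one_right (hS : Submonoid.closure S = ⊤) (ht : (t : G) = 1) : IsProdHead f t f := by
  refine ⟨LengthDvd.refl _, by simpa [ht] using LengthDvd.refl (1 : G), fun i hfi hi => ?_⟩
  have hfi1 : (f : G)⁻¹ * i = 1 := (ht ▸ hi).antisymm hS (one_lengthDvd _)
  obtain rfl : f = i := Subtype.ext (inv_mul_eq_one.1 hfi1)
  exact LengthDvd.refl (f : G)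

theorem mul_left (hw : IsBalanced S w) (hS : Submonoid.closure S = ⊤)
    (hmul : (f : G) * g = h) (hlen : wordLength S (f : G) + wordLength S (g : G) =
      wordLength S (h : G)) (hi : IsProdHead g t i) (hj : IsProdHead f i j) :
    IsProdHead h t j := by
  have hfh : LengthDvd S (f : G) h := ⟨g, hmul.symm, hlen.symm⟩
  have hg : (f : G)⁻¹ * h = g := by rw [← hmul, inv_mul_cancel_left]
  have hassoc (x : G) : (h : G)⁻¹ * x = (g : G)⁻¹ * ((f : G)⁻¹ * x) := by
    rw [← hmul, mul_inv_rev, mul_assoc]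
  have hhj : LengthDvd S (h : G) j := hj.2.2 h hfh (hg ▸ hi.1)
  refine ⟨hhj, ?_, fun x hhx hxt => ?_⟩
  · have hgj : LengthDvd S (g : G) ((f : G)⁻¹ * j) := hg ▸ hfh.quotient hS hhj
    exact hassoc j ▸ (hgj.quotient hS hj.2.1).trans hS hi.2.1
  · have hfx := hfh.trans hS hhx
    exact hj.2.2 x hfx (hi.2.2 ⟨(f : G)⁻¹ * x, hw.inv_mul_mem hS hfx x.2⟩
      (hg ▸ hfh.quotient hS hhx) (hassoc x ▸ hxt))

end IsProdHead

namespace IsGarsideInterval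

theorem exists_meet (H : IsGarsideInterval S w) (u v : lengthInterval S w) :
    ∃ d, IsGcdFor IntervalDvd u v d := by
  refine exists_isGcdFor_of_exists_isLcmFor
    (fun c : lengthInterval S w => wordLength S (u : G) - wordLength S (c : G)) ?_
    ⟨⟨1, one_mem_lengthInterval⟩, one_lengthDvd _, one_lengthDvd _⟩ H.exists_join
  intro c m hcm hmu hle
  have hmu' := hmu.wordLength_le
  exact Subtype.ext (hcm.eq_of_wordLength_le H.closure_eq_top (by omega))

theorem exists_isProdHead (H : IsGarsideInterval S w) (f t : lengthInterval S w) :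
    ∃ j, IsProdHead f t j := by
  have hS := H.closure_eq_top
  have hfw := mem_lengthInterval.1 f.2
  obtain ⟨d, hdw, hdt, hd⟩ :=
    H.exists_meet ⟨(f : G)⁻¹ * w, H.isBalanced.inv_mul_top_mem f.2⟩ t
  have hfd : LengthDvd S (f : G) (f * d) := hfw.self_mul hS hdw
  refine ⟨⟨f * d, mem_lengthInterval.2 (hfw.mul_of_quotient hS hdw)⟩, hfd, ?_, ?_⟩
  · rwa [inv_mul_cancel_left]
  · refine fun i hfi hit => hfi.of_quotient hfd ?_
    rw [inv_mul_cancel_left]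
    exact hd ⟨(f : G)⁻¹ * i, H.isBalanced.inv_mul_mem hS hfi i.2⟩
      (hfi.quotient hS (mem_lengthInterval.1 i.2)) hit

/-- The head of the formal product of `f` and `t`. -/
noncomputable def prodHead (H : IsGarsideInterval S w) (f t : lengthInterval S w) :
    lengthInterval S w :=
  (H.exists_isProdHead f t).choose

theorem isProdHead_prodHead (H : IsGarsideInterval S w) (f t : lengthInterval S w) :
    IsProdHead f t (H.prodHead f t) :=
  (H.exists_isProdHead f t).choose_spec

theorem prodHead_eq (H : IsGarsideInterval S w) {f t j : lengthInterval S w}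
    (hj : IsProdHead f t j) : H.prodHead f t = j :=
  (H.isProdHead_prodHead f t).unique H.closure_eq_top hj

/-- Left multiplication by the simple `f` on pairs `(t, m)`, thought of as the product of the
simple `t`, the head, and the monoid element `m`: the head of `f * t` is split off. -/
noncomputable def headStep (H : IsGarsideInterval S w) (f : lengthInterval S w)
    (p : lengthInterval S w × IntervalMonoid S w) : lengthInterval S w × IntervalMonoid S w :=
  (H.prodHead f p.1, intervalSimple S w (((f : G)⁻¹ * H.prodHead f p.1)⁻¹ * p.1) * p.2)

theorem headStep_one (H : IsGarsideInterval S w) {u : lengthInterval S w} (hu : (u : G) = 1)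
    (p : lengthInterval S w × IntervalMonoid S w) : H.headStep u p = p := by
  have hhead : H.prodHead u p.1 = p.1 := H.prodHead_eq (IsProdHead.one_left hu)
  ext1
  · exact hhead
  · simp [headStep, hhead, hu, intervalSimple_one]

theorem headStep_headStep (H : IsGarsideInterval S w) {f g h : lengthInterval S w}
    (hmul : (f : G) * g = h)
    (hlen : wordLength S (f : G) + wordLength S (g : G) = wordLength S (h : G))
    (p : lengthInterval S w × IntervalMonoid S w) :
    H.headStep f (H.headStep g p) = H.headStep h p := by
  obtain ⟨t, m⟩ := p
  have hS := H.closure_eq_top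
  have hi := H.isProdHead_prodHead g t
  have hj := H.isProdHead_prodHead f (H.prodHead g t)
  have hh := IsProdHead.mul_left H.isBalanced hS hmul hlen hi hj
  have hhead := H.prodHead_eq hh
  simp only [headStep, hhead, ← mul_assoc]
  generalize H.prodHead g t = i at *
  generalize H.prodHead f i = j at *
  have hquot : ((f : G)⁻¹ * j)⁻¹ * i = ((h : G)⁻¹ * j)⁻¹ * ((g : G)⁻¹ * i) := by
    rw [← hmul]
    group
  have hle : LengthDvd S ((h : G)⁻¹ * j) ((g : G)⁻¹ * i) := by
    have hgj : LengthDvd S (g : G) ((f : G)⁻¹ * j) := by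
      simpa [← hmul] using (show LengthDvd S (f : G) h from ⟨g, hmul.symm, hlen.symm⟩).quotient
        hS hh.1
    simpa [← hmul, mul_assoc] using hgj.quotient hS hj.2.1
  rw [hquot, H.isBalanced.intervalSimple_quotient_mul hS hle hi.2.1 t.2]

/-- The action of the interval monoid on pairs of a simple and a monoid element through which the
greatest simple divisor of an element is computed. -/
noncomputable def headAction (H : IsGarsideInterval S w) :
    IntervalMonoid S w →* Function.End (lengthInterval S w × IntervalMonoid S w) :=
  PresentedMonoid.lift (rels := IntervalRel S w)
    (M := Function.End (lengthInterval S w × IntervalMonoid S w)) H.headStep (by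
    rintro _ _ (⟨f, g, h, hmul, hlen⟩ | ⟨u, hu⟩)
    · exact funext (H.headStep_headStep hmul hlen)
    · exact funext (H.headStep_one hu))

/-- The greatest simple divisor of an element of the interval monoid and the remaining factor. -/
noncomputable def headTail (H : IsGarsideInterval S w) (m : IntervalMonoid S w) :
    lengthInterval S w × IntervalMonoid S w :=
  H.headAction m (⟨1, one_mem_lengthInterval⟩, 1)

theorem headTail_one (H : IsGarsideInterval S w) :
    H.headTail 1 = (⟨1, one_mem_lengthInterval⟩, 1) := by
  rw [headTail, map_one]
  rfl

theorem headTail_intervalSimple_mul (H : IsGarsideInterval S w) (s : lengthInterval S w)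
    (m : IntervalMonoid S w) :
    H.headTail (intervalSimple S w s * m) = H.headStep s (H.headTail m) := by
  rw [headTail, map_mul, intervalSimple_coe]
  rfl

theorem intervalSimple_head_mul_tail (H : IsGarsideInterval S w) (m : IntervalMonoid S w) :
    intervalSimple S w (H.headTail m).1 * (H.headTail m).2 = m := by
  induction m using intervalMonoid_induction with
  | one => simp [headTail_one, intervalSimple_one]
  | mul s m ih =>
    have hS := H.closure_eq_top
    have hw := H.isBalanced
    have hhead := H.isProdHead_prodHead s (H.headTail m).1
    rw [headTail_intervalSimple_mul, headStep,
      ← hw.intervalSimple_mul_quotient hS hhead.1 (H.prodHead s _).2, mul_assoc, ← mul_assoc _ _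
      (H.headTail m).2, hw.intervalSimple_mul_quotient hS hhead.2.1 (H.headTail m).1.2, ih]

theorem lengthDvd_head (H : IsGarsideInterval S w) (s : lengthInterval S w)
    (m : IntervalMonoid S w) :
    LengthDvd S (s : G) (H.headTail (intervalSimple S w s * m)).1 := by
  rw [headTail_intervalSimple_mul]
  exact (H.isProdHead_prodHead s _).1

theorem eq_intervalSimple_quotient_mul_tail (H : IsGarsideInterval S w) (s : lengthInterval S w)
    (m : IntervalMonoid S w) :
    m = intervalSimple S w ((s : G)⁻¹ * (H.headTail (intervalSimple S w s * m)).1) *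
      (H.headTail (intervalSimple S w s * m)).2 := by
  have hhead := H.isProdHead_prodHead s (H.headTail m).1
  rw [headTail_intervalSimple_mul, headStep, ← mul_assoc,
    H.isBalanced.intervalSimple_mul_quotient H.closure_eq_top hhead.2.1 (H.headTail m).1.2,
    intervalSimple_head_mul_tail]

theorem isLeftCancelMul (H : IsGarsideInterval S w) : IsLeftCancelMul (IntervalMonoid S w) := by
  refine ⟨fun f g h hgh => ?_⟩
  induction f using intervalMonoid_induction with
  | one => simpa using hgh
  | mul s m ih =>
    have hgh : intervalSimple S w s * (m * g) = intervalSimple S w s * (m * h) := by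
      simpa only [mul_assoc] using hgh
    refine ih ?_
    change m * g = m * h
    rw [H.eq_intervalSimple_quotient_mul_tail s (m * g), hgh,
      ← H.eq_intervalSimple_quotient_mul_tail s (m * h)]

theorem exists_eq_mul_of_mul_eq_mul (H : IsGarsideInterval S w) {s t : lengthInterval S w}
    {a b : IntervalMonoid S w} (hab : intervalSimple S w s * a = intervalSimple S w t * b) :
    ∃ j : lengthInterval S w, LengthDvd S (s : G) j ∧ LengthDvd S (t : G) j ∧
      ∃ c, b = intervalSimple S w ((t : G)⁻¹ * j) * c :=
  ⟨_, H.lengthDvd_head s a, hab ▸ H.lengthDvd_head t b, _,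
    hab ▸ H.eq_intervalSimple_quotient_mul_tail t b⟩

theorem exists_lcm_intervalSimple (H : IsGarsideInterval S w) (s : lengthInterval S w)
    (b : IntervalMonoid S w) :
    ∃ m, IsLcmFor (fun a b => a ∣ b) (intervalSimple S w s) b m := by
  induction b using intervalMonoid_induction generalizing s with
  | one => exact ⟨_, dvd_rfl, one_dvd _, fun c h _ => h⟩
  | mul t b ih =>
    have hS := H.closure_eq_top
    have hw := H.isBalanced
    obtain ⟨j, hsj, htj, hj⟩ := H.exists_join s t
    obtain ⟨l, hjl, hbl, hl⟩ := ih ⟨_, hw.inv_mul_mem hS htj j.2⟩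
    refine ⟨intervalSimple S w t * l, ?_, mul_dvd_mul_left _ hbl, ?_⟩
    · refine dvd_trans ?_ (mul_dvd_mul_left _ hjl)
      rw [hw.intervalSimple_mul_quotient hS htj j.2, ← hw.intervalSimple_mul_quotient hS hsj j.2]
      exact dvd_mul_right _ _
    · rintro _ ⟨z, rfl⟩ ⟨y, hy⟩
      rw [mul_assoc] at hy
      obtain ⟨i, hsi, hti, c, hc⟩ := H.exists_eq_mul_of_mul_eq_mul hy
      rw [hy]
      refine mul_dvd_mul_left _ (hl _ ?_ (dvd_mul_right _ _))
      change intervalSimple S w ((t : G)⁻¹ * j) ∣ b * y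
      rw [hc, ← hw.intervalSimple_quotient_mul hS htj (hj i hsi hti) i.2, mul_assoc]
      exact dvd_mul_right _ _

theorem exists_lcm (H : IsGarsideInterval S w) (a b : IntervalMonoid S w) :
    ∃ m, IsLcmFor (fun a b => a ∣ b) a b m := by
  have := H.isLeftCancelMul
  induction a using intervalMonoid_induction generalizing b with
  | one => exact ⟨b, one_dvd _, dvd_rfl, fun c _ h => h⟩
  | mul s a ih =>
    obtain ⟨_, ⟨g, rfl⟩, hb, hm⟩ := H.exists_lcm_intervalSimple s b
    obtain ⟨l, hal, hgl, hl⟩ := ih g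
    refine ⟨intervalSimple S w s * l, mul_dvd_mul_left _ hal,
      hb.trans (mul_dvd_mul_left _ hgl), ?_⟩
    rintro _ ⟨y, rfl⟩ hc
    obtain ⟨z, hz⟩ := hm _ ⟨a * y, mul_assoc _ _ _⟩ hc
    rw [mul_assoc, mul_assoc] at hz
    rw [mul_assoc]
    exact mul_dvd_mul_left _ (hl _ (dvd_mul_right _ _) ⟨z, mul_left_cancel hz⟩)

theorem lengthDvd_of_intervalSimple_dvd (H : IsGarsideInterval S w) {s v : lengthInterval S w}
    (h : intervalSimple S w s ∣ intervalSimple S w v) : LengthDvd S (s : G) v := by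
  obtain ⟨m, hm⟩ := h
  have hhead : (H.headTail (intervalSimple S w v)).1 = v := by
    rw [← mul_one (intervalSimple S w v), headTail_intervalSimple_mul, headTail_one]
    exact H.prodHead_eq (IsProdHead.one_right H.closure_eq_top rfl)
  simpa only [← hm, hhead] using H.lengthDvd_head s m

theorem dvd_intervalSimple_iff (H : IsGarsideInterval S w) {v : G} (hv : v ∈ lengthInterval S w)
    {m : IntervalMonoid S w} :
    m ∣ intervalSimple S w v ↔ ∃ u, LengthDvd S u v ∧ intervalSimple S w u = m := by
  have hS := H.closure_eq_top
  have hw := H.isBalanced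
  have := H.isLeftCancelMul
  constructor
  · intro hm
    induction m using intervalMonoid_induction generalizing v with
    | one => exact ⟨1, one_lengthDvd v, intervalSimple_one⟩
    | mul s m ih =>
      have hsv : LengthDvd S (s : G) v :=
        H.lengthDvd_of_intervalSimple_dvd (v := ⟨v, hv⟩) ((dvd_mul_right _ m).trans hm)
      obtain ⟨c, hc⟩ := hm
      rw [← hw.intervalSimple_mul_quotient hS hsv hv, mul_assoc] at hc
      obtain ⟨x, hxv, rfl⟩ := ih (hw.inv_mul_mem hS hsv hv) ⟨c, mul_left_cancel hc⟩
      have hsx := hsv.self_mul hS hxv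
      have hsxv := hsv.mul_of_quotient hS hxv
      refine ⟨s * x, hsxv, ?_⟩
      simpa using (hw.intervalSimple_mul_quotient hS hsx
        (mem_lengthInterval_of_lengthDvd hS hsxv hv)).symm
  · rintro ⟨u, huv, rfl⟩
    exact ⟨_, (hw.intervalSimple_mul_quotient hS huv hv).symm⟩

theorem dvd_intervalTop_iff (H : IsGarsideInterval S w) {m : IntervalMonoid S w} :
    m ∣ intervalTop S w ↔ m ∈ Set.range (intervalCopy S w) := by
  rw [intervalTop_eq_intervalSimple, H.dvd_intervalSimple_iff (self_mem_lengthInterval S w)]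
  constructor
  · rintro ⟨u, hu, rfl⟩
    exact ⟨⟨u, mem_lengthInterval.2 hu⟩, (intervalSimple_coe _).symm⟩
  · rintro ⟨u, rfl⟩
    exact ⟨u, mem_lengthInterval.1 u.2, intervalSimple_coe u⟩

theorem garsideSimples_intervalTop (H : IsGarsideInterval S w) :
    garsideSimples (intervalTop S w) = Set.range (intervalCopy S w) :=
  Set.ext fun _ => H.dvd_intervalTop_iff

theorem isGarsideMonoid (H : IsGarsideInterval S w) (hfin : (lengthInterval S w).Finite) :
    IsGarsideMonoid (IntervalMonoid S w) (intervalTop S w) := by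
  have := H.isLeftCancelMul
  have := hfin.to_subtype
  have hdiv : {f | f ∣ intervalTop S w} = Set.range (intervalCopy S w) :=
    H.garsideSimples_intervalTop
  refine (H.isBalanced.isQuasiCentral_intervalTop H.closure_eq_top).isGarsideMonoid
    (wt := fun m => (intervalWeight S w m).toAdd) (fun f g => by simp)
    (toAdd_intervalWeight_ne_zero H.closure_eq_top) H.exists_lcm ?_ ?_
  · rw [hdiv]
    exact PresentedMonoid.closure_range_of _
  · rw [hdiv]
    exact Set.finite_range _

end IsGarsideInterval

end GarsideInterval

/-! ### Permutation and entries of an element of `G(e,e,n)` -/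

section Monomial

variable {e n : ℕ}

namespace IsMonomialWith

variable {A B : Matrix (Fin n) (Fin n) ℂ} {σ τ : Equiv.Perm (Fin n)} {a b : Fin n → ℂ}

theorem perm_eq_and_entry_eq (hA : IsMonomialWith A σ a) (hB : IsMonomialWith A τ b)
    (ha : ∀ i, a i ≠ 0) : σ = τ ∧ a = b := by
  have row_eq (i : Fin n) : σ i = τ i ∧ a i = b i := by
    have hentry : (if τ i = σ i then b i else 0) = a i := by rw [← hB, hA, if_pos rfl]
    split_ifs at hentry with hστ
    · exact ⟨hστ.symm, hentry.symm⟩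
    · exact absurd hentry.symm (ha i)
  exact ⟨Equiv.ext fun i => (row_eq i).1, funext fun i => (row_eq i).2⟩

theorem matrix_eq (hA : IsMonomialWith A σ a) (hB : IsMonomialWith B σ a) : A = B := by
  ext i j
  rw [hA, hB]

end IsMonomialWith

/-- The permutation underlying an element of `G(e,e,n)`: row `i` is supported in column
`geenPerm g i`. It reverses products, see `geenPerm_mul`. -/
noncomputable def geenPerm (g : Geen e n) : Equiv.Perm (Fin n) := Classical.choose g.2

/-- The nonzero entry of row `i` of an element of `G(e,e,n)`. -/
noncomputable def geenEntry (g : Geen e n) : Fin n → ℂ :=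
  Classical.choose (Classical.choose_spec g.2)

theorem geen_isMonomialWith (g : Geen e n) :
    IsMonomialWith ((g : GL (Fin n) ℂ) : Matrix (Fin n) (Fin n) ℂ) (geenPerm g) (geenEntry g) :=
  (Classical.choose_spec (Classical.choose_spec g.2)).1

theorem geenEntry_pow (g : Geen e n) (i : Fin n) : geenEntry g i ^ e = 1 :=
  (Classical.choose_spec (Classical.choose_spec g.2)).2.1 i

theorem prod_geenEntry (g : Geen e n) : ∏ i, geenEntry g i = 1 :=
  (Classical.choose_spec (Classical.choose_spec g.2)).2.2

theorem geenEntry_ne_zero (g : Geen e n) (i : Fin n) : geenEntry g i ≠ 0 :=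
  Finset.prod_ne_zero_iff.1 (prod_geenEntry g ▸ one_ne_zero) i (Finset.mem_univ i)

theorem geen_eq_of_isMonomialWith {g : Geen e n} {σ : Equiv.Perm (Fin n)} {a : Fin n → ℂ}
    (h : IsMonomialWith ((g : GL (Fin n) ℂ) : Matrix (Fin n) (Fin n) ℂ) σ a) :
    geenPerm g = σ ∧ geenEntry g = a :=
  (geen_isMonomialWith g).perm_eq_and_entry_eq h (geenEntry_ne_zero g)

theorem geen_ext {g h : Geen e n} (hperm : ∀ i, geenPerm g i = geenPerm h i)
    (hentry : ∀ i, geenEntry g i = geenEntry h i) : g = h := by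
  have hg := geen_isMonomialWith g
  rw [Equiv.ext hperm, funext hentry] at hg
  exact Subtype.ext (Units.ext (hg.matrix_eq (geen_isMonomialWith h)))

theorem geen_mul_isMonomialWith (g h : Geen e n) :
    IsMonomialWith (((g * h : Geen e n) : GL (Fin n) ℂ) : Matrix (Fin n) (Fin n) ℂ)
      (geenPerm h * geenPerm g) fun i => geenEntry g i * geenEntry h (geenPerm g i) := by
  simpa using (geen_isMonomialWith g).mul (geen_isMonomialWith h)

theorem geenPerm_mul (g h : Geen e n) : geenPerm (g * h) = geenPerm h * geenPerm g :=
  (geen_eq_of_isMonomialWith (geen_mul_isMonomialWith g h)).1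

theorem geenEntry_mul (g h : Geen e n) (i : Fin n) :
    geenEntry (g * h) i = geenEntry g i * geenEntry h (geenPerm g i) :=
  congrFun (geen_eq_of_isMonomialWith (geen_mul_isMonomialWith g h)).2 i

theorem geen_one_isMonomialWith :
    IsMonomialWith (((1 : Geen e n) : GL (Fin n) ℂ) : Matrix (Fin n) (Fin n) ℂ) 1 fun _ => 1 :=
  fun _ _ => Matrix.one_apply

theorem geenPerm_one : geenPerm (1 : Geen e n) = 1 :=
  (geen_eq_of_isMonomialWith geen_one_isMonomialWith).1

theorem geenEntry_one (i : Fin n) : geenEntry (1 : Geen e n) i = 1 :=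
  congrFun (geen_eq_of_isMonomialWith geen_one_isMonomialWith).2 i

theorem exists_geen (σ : Equiv.Perm (Fin n)) (a : Fin n → ℂ) (ha : ∀ i, a i ^ e = 1)
    (hprod : ∏ i, a i = 1) : ∃ g : Geen e n, geenPerm g = σ ∧ geenEntry g = a := by
  have ha0 (i : Fin n) : a i ≠ 0 :=
    Finset.prod_ne_zero_iff.1 (hprod ▸ one_ne_zero) i (Finset.mem_univ i)
  let A : Matrix (Fin n) (Fin n) ℂ := .of fun i j => if σ i = j then a i else 0
  let B : Matrix (Fin n) (Fin n) ℂ := .of fun i j => if σ⁻¹ i = j then (a (σ⁻¹ i))⁻¹ else 0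
  have hA : IsMonomialWith A σ a := fun _ _ => rfl
  have hB : IsMonomialWith B σ⁻¹ fun i => (a (σ⁻¹ i))⁻¹ := fun _ _ => rfl
  have hAB : A * B = 1 := by
    ext i j
    simp [hA.mul hB i j, Matrix.one_apply, ha0]
  exact ⟨⟨Matrix.GeneralLinearGroup.mkOfDetNeZero A (Matrix.det_ne_zero_of_right_inverse hAB),
    σ, a, hA, ha, hprod⟩, geen_eq_of_isMonomialWith hA⟩

theorem finite_geen (he : 0 < e) : Finite (Geen e n) := by
  have hroots : {z : ℂ | z ^ e = 1}.Finite := by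
    refine (Polynomial.nthRoots e (1 : ℂ)).toFinset.finite_toSet.subset fun z hz => ?_
    simpa [Polynomial.mem_nthRoots he] using hz
  have := hroots.to_subtype
  refine Finite.of_injective (β := Equiv.Perm (Fin n) × (Fin n → {z : ℂ | z ^ e = 1}))
    (fun g => (geenPerm g, fun i => ⟨geenEntry g i, geenEntry_pow g i⟩)) fun g h hgh => ?_
  rw [Prod.mk.injEq] at hgh
  exact geen_ext (fun i => by rw [hgh.1]) fun i => congrArg Subtype.val (congrFun hgh.2 i)

/-! ### The generators as row operations -/

/-- The nonzero entries of the matrix that swaps the rows `p` and `q` and rescales them by `z⁻¹`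
and `z` respectively. -/
noncomputable def rowSwapEntry (p q : Fin n) (z : ℂ) (i : Fin n) : ℂ :=
  if i = p then z⁻¹ else if i = q then z else 1

/-- Uniform description of the Corran–Picantin generators: `g` swaps the consecutive rows `p` and
`q` up to the scalar `z`, which is `1` unless `p` is the first row. Thus `t_i` is the case where
`p` is the first row and `z = ζ_eⁱ`. -/
structure IsRowSwap (g : Geen e n) (p q : Fin n) (z : ℂ) : Prop where
  succ : p.val + 1 = q.val
  pow_eq : z ^ e = 1
  scalar : p.val ≠ 0 → z = 1
  perm : geenPerm g = Equiv.swap p q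
  entry : geenEntry g = rowSwapEntry p q z

theorem tMatrix_isMonomialWith {p q : Fin n} (hp : p.val = 0) (hq : q.val = 1) (i : ℕ) :
    IsMonomialWith (tMatrix e n i) (Equiv.swap p q) (rowSwapEntry p q (zetaRoot e ^ i)) := by
  intro r c
  simp only [tMatrix, Matrix.of_apply, Equiv.swap_apply_def, rowSwapEntry, Fin.ext_iff, hp, hq,
    inv_pow]
  split_ifs <;> first | rfl | (exfalso; omega)

theorem sMatrix_isMonomialWith {p q : Fin n} {j : ℕ} (hp : p.val + 2 = j) (hq : q.val + 1 = j) :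
    IsMonomialWith (sMatrix n j) (Equiv.swap p q) (rowSwapEntry p q 1) := by
  intro r c
  simp only [sMatrix, Matrix.of_apply, Equiv.swap_apply_def, rowSwapEntry, Fin.ext_iff, inv_one,
    ite_self]
  split_ifs <;> first | rfl | (exfalso; omega)

theorem zetaRoot_pow_pow (i : ℕ) : (zetaRoot e ^ i) ^ e = 1 := by
  rw [pow_right_comm, zetaRoot_pow, one_pow]

theorem exists_isRowSwap_of_mem (hn : 2 ≤ n) {g : Geen e n} (hg : g ∈ corranPicantinGens e n) :
    ∃ p q z, IsRowSwap g p q z := by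
  rcases hg with ⟨i, -, hg⟩ | ⟨j, hj, hjn, hg⟩
  · have ht := tMatrix_isMonomialWith (e := e) (p := (⟨0, by omega⟩ : Fin n))
      (q := ⟨1, by omega⟩) rfl rfl i
    obtain ⟨hperm, hentry⟩ := geen_eq_of_isMonomialWith (hg ▸ ht)
    exact ⟨_, _, _, rfl, zetaRoot_pow_pow i, fun h => absurd rfl h, hperm, hentry⟩
  · have hp : j - 2 + 2 = j := by omega
    have hq : j - 1 + 1 = j := by omega
    have hs := sMatrix_isMonomialWith (p := (⟨j - 2, by omega⟩ : Fin n))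
      (q := ⟨j - 1, by omega⟩) hp hq
    obtain ⟨hperm, hentry⟩ := geen_eq_of_isMonomialWith (hg ▸ hs)
    exact ⟨_, _, _, by simp only; omega, one_pow _, fun _ => rfl, hperm, hentry⟩

theorem prod_rowSwapEntry {p q : Fin n} (hpq : p ≠ q) {z : ℂ} (hz : z ≠ 0) :
    ∏ i, rowSwapEntry p q z i = 1 := by
  rw [Fintype.prod_eq_mul p q hpq fun i hi => by rw [rowSwapEntry, if_neg hi.1, if_neg hi.2]]
  simp [rowSwapEntry, hpq.symm, hz]

theorem exists_isRowSwap (he : 0 < e) {p q : Fin n} {z : ℂ} (hpq : p.val + 1 = q.val)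
    (hz : z ^ e = 1) (hscalar : p.val ≠ 0 → z = 1) : ∃ g : Geen e n, IsRowSwap g p q z := by
  have hz0 : z ≠ 0 := (IsUnit.of_pow_eq_one hz he.ne').ne_zero
  have hne : p ≠ q := Fin.ne_of_val_ne (by omega)
  obtain ⟨g, hperm, hentry⟩ := exists_geen (e := e) (Equiv.swap p q) (rowSwapEntry p q z)
    (fun i => by unfold rowSwapEntry; split_ifs <;> simp [hz]) (prod_rowSwapEntry hne hz0)
  exact ⟨g, hpq, hz, hscalar, hperm, hentry⟩

namespace IsRowSwap

variable {g : Geen e n} {p q : Fin n} {z : ℂ}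

theorem lt (h : IsRowSwap g p q z) : p < q :=
  Fin.lt_def.2 (h.succ ▸ Nat.lt_succ_self _)

theorem ne (h : IsRowSwap g p q z) : p ≠ q := h.lt.ne

theorem two_le (h : IsRowSwap g p q z) : 2 ≤ n := by
  have := h.succ
  omega

theorem scalar_ne_zero (h : IsRowSwap g p q z) : z ≠ 0 := by
  simpa [h.entry, rowSwapEntry, h.ne.symm] using geenEntry_ne_zero g q

theorem mem_corranPicantinGens (h : IsRowSwap g p q z) (he : 0 < e) :
    g ∈ corranPicantinGens e n := by
  have hg := geen_isMonomialWith g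
  rw [h.perm, h.entry] at hg
  have hpq := h.succ
  by_cases hp : p.val = 0
  · have : NeZero e := ⟨he.ne'⟩
    obtain ⟨i, hi, rfl⟩ := (Complex.isPrimitiveRoot_exp e he.ne').eq_pow_of_pow_eq_one h.pow_eq
    exact Or.inl ⟨i, hi, hg.matrix_eq (tMatrix_isMonomialWith hp (by omega) i)⟩
  · rw [h.scalar hp] at hg
    exact Or.inr ⟨p.val + 2, by omega, by omega,
      hg.matrix_eq (sMatrix_isMonomialWith rfl (by omega))⟩

theorem eq_of_scalar_eq {g' : Geen e n} (h : IsRowSwap g p q z) (h' : IsRowSwap g' p q z) :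
    g = g' :=
  geen_ext (fun i => by rw [h.perm, h'.perm]) fun i => by rw [h.entry, h'.entry]

theorem perm_mul (h : IsRowSwap g p q z) (x : Geen e n) (i : Fin n) :
    geenPerm (g * x) i =
      if i = p then geenPerm x q else if i = q then geenPerm x p else geenPerm x i := by
  rw [geenPerm_mul, h.perm, Equiv.Perm.mul_apply, Equiv.swap_apply_def]
  split_ifs <;> rfl

theorem entry_mul (h : IsRowSwap g p q z) (x : Geen e n) (i : Fin n) :
    geenEntry (g * x) i =
      if i = p then z⁻¹ * geenEntry x q
      else if i = q then z * geenEntry x p else geenEntry x i := by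
  rw [geenEntry_mul, h.perm, h.entry, Equiv.swap_apply_def, rowSwapEntry]
  split_ifs <;> simp

theorem mul_self (h : IsRowSwap g p q z) : g * g = 1 := by
  have hne := h.ne
  have hz := h.scalar_ne_zero
  refine geen_ext (fun i => ?_) fun i => ?_
  · rw [geenPerm_mul, h.perm, geenPerm_one, Equiv.swap_mul_self]
  · rw [h.entry_mul, h.entry, geenEntry_one]
    unfold rowSwapEntry
    split_ifs <;> simp_all

theorem inv_eq (h : IsRowSwap g p q z) : g⁻¹ = g := inv_eq_of_mul_eq_one_left h.mul_self

end IsRowSwap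

/-! ### The length function of `G(e,e,n)` -/

/-- The contribution of the rows `j < i` to the length: `1` for an inversion, and otherwise `0` or
`2` according to whether the entry of row `i` is `1`. -/
noncomputable def pairLength (g : Geen e n) (j i : Fin n) : ℕ :=
  open Classical in
  if j < i then
    (if geenPerm g i < geenPerm g j then 1 else if geenEntry g i = 1 then 0 else 2) else 0

/-- The length over the Corran–Picantin generators, read off the matrix; see
`wordLength_eq_geenLength`. -/
noncomputable def geenLength (g : Geen e n) : ℕ := ∑ x : Fin n × Fin n, pairLength g x.1 x.2

/-- Left multiplication by the generator that swaps the rows `p` and `q` with scalar `z` shortens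
`g`; see `IsRowSwap.lengthDvd_iff`. -/
def IsDescent (g : Geen e n) (p q : Fin n) (z : ℂ) : Prop :=
  (geenPerm g q < geenPerm g p ∧ z * geenEntry g p = 1) ∨
    (geenPerm g p < geenPerm g q ∧ geenEntry g q ≠ 1)

theorem pairLength_le_two (g : Geen e n) (j i : Fin n) : pairLength g j i ≤ 2 := by
  unfold pairLength
  split_ifs <;> omega

theorem geenLength_one : geenLength (1 : Geen e n) = 0 := by
  refine Finset.sum_eq_zero fun x _ => ?_
  by_cases hx : x.1 < x.2
  · simp [pairLength, geenPerm_one, geenEntry_one, hx.not_gt]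
  · simp [pairLength, hx]

theorem swap_lt_swap_iff {p q i j : Fin n} (hpq : p.val + 1 = q.val) (h : ¬(j = p ∧ i = q))
    (h' : ¬(j = q ∧ i = p)) : Equiv.swap p q j < Equiv.swap p q i ↔ j < i := by
  simp only [Equiv.swap_apply_def, Fin.ext_iff, Fin.lt_def] at *
  split_ifs <;> omega

namespace IsRowSwap

variable {g : Geen e n} {p q : Fin n} {z : ℂ}

theorem rowSwapEntry_eq_one (h : IsRowSwap g p q z) {j i : Fin n} (hji : j < i)
    (hpq : ¬(j = p ∧ i = q)) : rowSwapEntry p q z i = 1 := by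
  by_cases hp : p.val = 0
  · have hsucc := h.succ
    simp only [Fin.ext_iff, Fin.lt_def] at hpq hji
    rw [rowSwapEntry, if_neg (Fin.ne_of_val_ne (by omega)), if_neg (Fin.ne_of_val_ne (by omega))]
  · simp [rowSwapEntry, h.scalar hp]

theorem pairLength_mul (h : IsRowSwap g p q z) (x : Geen e n) {j i : Fin n}
    (hpq : ¬(j = p ∧ i = q)) (hqp : ¬(j = q ∧ i = p)) :
    pairLength (g * x) j i = pairLength x (Equiv.swap p q j) (Equiv.swap p q i) := by
  simp only [pairLength, swap_lt_swap_iff h.succ hpq hqp]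
  by_cases hji : j < i
  · rw [geenEntry_mul, geenPerm_mul, h.entry, h.rowSwapEntry_eq_one hji hpq, one_mul, h.perm]
    rfl
  · simp only [hji, if_false]

theorem geenLength_mul_add (h : IsRowSwap g p q z) (x : Geen e n) :
    geenLength (g * x) + pairLength x p q = geenLength x + pairLength (g * x) p q := by
  have hx : geenLength x =
      ∑ y : Fin n × Fin n, pairLength x (Equiv.swap p q y.1) (Equiv.swap p q y.2) :=
    (Equiv.sum_comp ((Equiv.swap p q).prodCongr (Equiv.swap p q))
      (fun y : Fin n × Fin n => pairLength x y.1 y.2)).symm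
  have hsingle (r : Fin n × Fin n) (m : ℕ) :
      m = ∑ y : Fin n × Fin n, if y = r then m else 0 := by simp
  rw [hx, hsingle (q, p) (pairLength x p q), hsingle (p, q) (pairLength (g * x) p q), geenLength,
    ← Finset.sum_add_distrib, ← Finset.sum_add_distrib]
  refine Finset.sum_congr rfl fun ⟨j, i⟩ _ => ?_
  have hne := h.ne
  have hnot := h.lt.not_gt
  by_cases hpq : j = p ∧ i = q
  · obtain ⟨rfl, rfl⟩ := hpq
    simp [hne, pairLength, hnot]
  by_cases hqp : j = q ∧ i = p
  · obtain ⟨rfl, rfl⟩ := hqp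
    simp [hne.symm, pairLength, hnot]
  simpa only [Prod.mk.injEq, hpq, hqp, if_false, add_zero] using h.pairLength_mul x hpq hqp

theorem geenLength_of_isDescent (h : IsRowSwap g p q z) {x : Geen e n} (hx : IsDescent x p q z) :
    geenLength x = geenLength (g * x) + 1 := by
  have hpair : pairLength x p q = pairLength (g * x) p q + 1 := by
    simp only [pairLength, h.lt, if_true, h.perm_mul, h.entry_mul, h.ne.symm, if_false]
    rcases hx with ⟨hlt, hentry⟩ | ⟨hlt, hentry⟩ <;> simp [hlt, hlt.not_gt, hentry]
  have := h.geenLength_mul_add x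
  omega

theorem geenLength_of_not_isDescent (h : IsRowSwap g p q z) {x : Geen e n}
    (hx : ¬IsDescent x p q z) : geenLength (g * x) = geenLength x + 1 := by
  have hpair : pairLength (g * x) p q = pairLength x p q + 1 := by
    simp only [IsDescent, not_or, not_and, not_not] at hx
    simp only [pairLength, h.lt, if_true, h.perm_mul, h.entry_mul, h.ne.symm, if_false]
    rcases lt_or_gt_of_ne ((geenPerm x).injective.ne h.ne) with hlt | hlt
    · simp [hlt, hlt.not_gt, hx.2 hlt]
    · simp [hlt, hlt.not_gt, hx.1 hlt]
  have := h.geenLength_mul_add x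
  omega

theorem geenLength_mul_le (h : IsRowSwap g p q z) (x : Geen e n) :
    geenLength (g * x) ≤ geenLength x + 1 := by
  by_cases hx : IsDescent x p q z
  · have := h.geenLength_of_isDescent hx
    omega
  · exact (h.geenLength_of_not_isDescent hx).le

end IsRowSwap

theorem geen_eq_one_of_strictMono {x : Geen e n} (hmono : StrictMono (geenPerm x))
    (hentry : ∀ i : Fin n, i.val ≠ 0 → geenEntry x i = 1) : x = 1 := by
  have hperm (i : Fin n) : geenPerm x i = i :=
    DFunLike.congr_fun (Subsingleton.elim
      (hmono.orderIsoOfSurjective _ (geenPerm x).surjective) (OrderIso.refl (Fin n))) i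
  refine geen_ext (fun i => by rw [hperm, geenPerm_one, Equiv.Perm.one_apply]) fun i => ?_
  rw [geenEntry_one]
  by_cases hi : i.val = 0
  · rw [← prod_geenEntry x]
    exact (Fintype.prod_eq_single i fun j hj =>
      hentry j fun hj0 => hj (Fin.ext (hj0.trans hi.symm))).symm
  · exact hentry i hi

theorem strictMono_of_lt_succ_val {σ : Equiv.Perm (Fin n)}
    (h : ∀ p q : Fin n, p.val + 1 = q.val → σ p < σ q) : StrictMono σ := by
  cases n with
  | zero => exact fun i => i.elim0
  | succ n => exact Fin.strictMono_iff_lt_succ.2 fun i => h _ _ (by simp)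

theorem exists_isDescent {x : Geen e n} (hx : x ≠ 1) :
    ∃ p q z, p.val + 1 = q.val ∧ z ^ e = 1 ∧ (p.val ≠ 0 → z = 1) ∧ IsDescent x p q z := by
  contrapose! hx with hno
  have entry_of_lt {p q : Fin n} (hpq : p.val + 1 = q.val) (hlt : geenPerm x p < geenPerm x q) :
      geenEntry x q = 1 := by
    by_contra hentry
    exact hno p q 1 hpq (one_pow _) (fun _ => rfl) (Or.inr ⟨hlt, hentry⟩)
  have lt_of_entry {p q : Fin n} (hpq : p.val + 1 = q.val)
      (hentry : p.val ≠ 0 → geenEntry x p = 1) : geenPerm x p < geenPerm x q := by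
    have hne : q ≠ p := Fin.ne_of_val_ne (by omega)
    by_contra hlt
    exact hno p q (geenEntry x p)⁻¹ hpq (by simp [geenEntry_pow]) (fun hp => by simp [hentry hp])
      (Or.inl ⟨(not_lt.1 hlt).lt_of_ne ((geenPerm x).injective.ne hne),
        inv_mul_cancel₀ (geenEntry_ne_zero x p)⟩)
  have entry_eq_one (m : ℕ) (hm : m < n) : m ≠ 0 → geenEntry x ⟨m, hm⟩ = 1 := by
    induction m with
    | zero => exact fun h => absurd rfl h
    | succ m ih =>
      have hpq : (⟨m, by omega⟩ : Fin n).val + 1 = (⟨m + 1, hm⟩ : Fin n).val := rfl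
      exact fun _ => entry_of_lt hpq (lt_of_entry hpq (ih _))
  exact geen_eq_one_of_strictMono
    (strictMono_of_lt_succ_val fun p _ hpq => lt_of_entry hpq (entry_eq_one p p.2))
    fun i => entry_eq_one i i.2

theorem exists_generator_geenLength (he : 0 < e) {x : Geen e n} (hx : x ≠ 1) :
    ∃ s ∈ corranPicantinGens e n, ∃ y, x = s * y ∧ geenLength x = geenLength y + 1 := by
  obtain ⟨p, q, z, hpq, hz, hscalar, hdesc⟩ := exists_isDescent hx
  obtain ⟨s, hs⟩ := exists_isRowSwap he hpq hz hscalar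
  exact ⟨s, hs.mem_corranPicantinGens he, s * x, by rw [← mul_assoc, hs.mul_self, one_mul],
    hs.geenLength_of_isDescent hdesc⟩

theorem closure_corranPicantinGens (he : 0 < e) :
    Submonoid.closure (corranPicantinGens e n) = ⊤ :=
  closure_eq_top_of_descent geenLength_one fun _ => exists_generator_geenLength he

theorem wordLength_eq_geenLength (he : 0 < e) (hn : 2 ≤ n) (x : Geen e n) :
    wordLength (corranPicantinGens e n) x = geenLength x := by
  refine wordLength_eq_of_descent geenLength_one (fun _ => exists_generator_geenLength he)
    (fun s hs y => ?_) x
  obtain ⟨p, q, z, hs⟩ := exists_isRowSwap_of_mem hn hs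
  exact hs.geenLength_mul_le y

theorem wordLength_corranPicantinGens_inv (he : 0 < e) (hn : 2 ≤ n) (x : Geen e n) :
    wordLength (corranPicantinGens e n) x⁻¹ = wordLength (corranPicantinGens e n) x := by
  refine wordLength_inv (closure_corranPicantinGens he) (fun s hs => ?_) x
  obtain ⟨p, q, z, h⟩ := exists_isRowSwap_of_mem hn hs
  rwa [h.inv_eq]

namespace IsRowSwap

variable {g : Geen e n} {p q : Fin n} {z : ℂ}

theorem wordLength_eq (h : IsRowSwap g p q z) (he : 0 < e) :
    wordLength (corranPicantinGens e n) g = 1 := by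
  have hnot : ¬IsDescent (1 : Geen e n) p q z := by
    simp [IsDescent, geenPerm_one, geenEntry_one, h.lt.not_gt]
  rw [wordLength_eq_geenLength he h.two_le]
  simpa [geenLength_one] using h.geenLength_of_not_isDescent hnot

theorem lengthDvd_iff (h : IsRowSwap g p q z) (he : 0 < e) {x : Geen e n} :
    LengthDvd (corranPicantinGens e n) g x ↔ IsDescent x p q z := by
  rw [_root_.lengthDvd_iff, h.wordLength_eq he, h.inv_eq,
    wordLength_eq_geenLength he h.two_le, wordLength_eq_geenLength he h.two_le]
  by_cases hx : IsDescent x p q z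
  · have := h.geenLength_of_isDescent hx
    exact iff_of_true (by omega) hx
  · have := h.geenLength_of_not_isDescent hx
    exact iff_of_false (by omega) hx

end IsRowSwap

end Monomial

/-! ### The interval below a power of `λ` -/

section Lambda

variable {e n k : ℕ}

theorem lam_isMonomialWith :
    IsMonomialWith ((lam e n : GL (Fin n) ℂ) : Matrix (Fin n) (Fin n) ℂ) 1 (lamEntry e n) :=
  fun _ _ => Matrix.diagonal_apply _ _ _

theorem geenPerm_lam_pow (k : ℕ) : geenPerm (lam e n ^ k) = 1 := by
  induction k with
  | zero => rw [pow_zero, geenPerm_one]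
  | succ k ih =>
    rw [pow_succ, geenPerm_mul, ih, (geen_eq_of_isMonomialWith lam_isMonomialWith).1, one_mul]

theorem geenEntry_lam_pow (k : ℕ) {i : Fin n} (hi : i.val ≠ 0) :
    geenEntry (lam e n ^ k) i = zetaRoot e ^ k := by
  induction k with
  | zero => rw [pow_zero, geenEntry_one, pow_zero]
  | succ k ih =>
    rw [pow_succ, geenEntry_mul, ih, (geen_eq_of_isMonomialWith lam_isMonomialWith).2,
      geenPerm_lam_pow, Equiv.Perm.one_apply, lamEntry, if_neg hi, pow_succ]

theorem zetaRoot_pow_ne_one (hk : 1 ≤ k) (hke : k ≤ e - 1) : zetaRoot e ^ k ≠ 1 :=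
  (Complex.isPrimitiveRoot_exp e (by omega)).pow_ne_one_of_pos_of_lt (by omega) (by omega)

-- `λ ^ k` is scalar away from the first row and column, and these affect no pair contribution.
theorem geenLength_lam_pow_mul (k : ℕ) (u : Geen e n) :
    geenLength (lam e n ^ k * u) = geenLength (u * lam e n ^ k) := by
  refine Finset.sum_congr rfl fun ⟨j, i⟩ _ => ?_
  simp only [pairLength, geenPerm_mul, geenEntry_mul, geenPerm_lam_pow, mul_one, one_mul,
    Equiv.Perm.one_apply]
  by_cases hji : j < i
  · by_cases hinv : geenPerm u i < geenPerm u j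
    · simp only [hinv, if_true]
    · have hlt : geenPerm u j < geenPerm u i :=
        (not_lt.1 hinv).lt_of_ne ((geenPerm u).injective.ne hji.ne)
      rw [geenEntry_lam_pow k (Nat.ne_zero_of_lt hji), geenEntry_lam_pow k (Nat.ne_zero_of_lt hlt),
        mul_comm]
  · simp only [hji, if_false]

theorem isBalanced_lam_pow (he : 0 < e) (hn : 2 ≤ n) (k : ℕ) :
    IsBalanced (corranPicantinGens e n) (lam e n ^ k) := by
  intro u
  rw [lengthDvd_iff, add_comm, wordLength_eq_geenLength he hn (u⁻¹ * _),
    ← geenLength_lam_pow_mul, ← wordLength_eq_geenLength he hn]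

theorem two_le_pairLength_add {x y : Geen e n} (hperm : geenPerm x = geenPerm y) {j i : Fin n}
    (hji : j < i) (hentry : geenEntry x i ≠ geenEntry y i) :
    2 ≤ pairLength x j i + pairLength y j i := by
  simp only [pairLength, hji, if_true, hperm]
  by_cases hinv : geenPerm y i < geenPerm y j
  · simp [hinv]
  · by_cases hx : geenEntry x i = 1
    · simp [hinv, hx, (hx ▸ hentry).symm]
    · simp [hinv, hx]

theorem pairLength_lam_pow_le (hk : 1 ≤ k) (hke : k ≤ e - 1) (y : Geen e n) (j i : Fin n) :
    pairLength (lam e n ^ k) j i ≤ pairLength (lam e n ^ k * y) j i + pairLength y j i := by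
  by_cases hji : j < i
  · refine (pairLength_le_two _ j i).trans (two_le_pairLength_add ?_ hji ?_)
    · rw [geenPerm_mul, geenPerm_lam_pow, mul_one]
    · rw [geenEntry_mul, geenEntry_lam_pow k (Nat.ne_zero_of_lt hji), geenPerm_lam_pow]
      exact fun h => zetaRoot_pow_ne_one hk hke ((mul_eq_right₀ (geenEntry_ne_zero y i)).1 h)
  · simp [pairLength, hji]

theorem pairLength_lam_pow (hk : 1 ≤ k) (hke : k ≤ e - 1) {j i : Fin n} (hji : j < i) :
    pairLength (lam e n ^ k) j i = 2 := by
  simp [pairLength, hji, geenPerm_lam_pow, hji.not_gt, zetaRoot_pow_ne_one hk hke,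
    geenEntry_lam_pow k (Nat.ne_zero_of_lt hji)]

-- Additivity of lengths forces `pairLength_lam_pow_le` to be an equality for each pair of rows.
theorem geenEntry_of_geenLength_add (hk : 1 ≤ k) (hke : k ≤ e - 1) {y : Geen e n}
    (hy : geenLength (lam e n ^ k) = geenLength (lam e n ^ k * y) + geenLength y)
    {j i : Fin n} (hji : j < i) (hlt : geenPerm (lam e n ^ k * y) j < geenPerm (lam e n ^ k * y) i)
    (hi : geenEntry (lam e n ^ k * y) i ≠ 1) :
    geenEntry (lam e n ^ k * y) i = zetaRoot e ^ k := by
  rw [geenLength, geenLength, geenLength, ← Finset.sum_add_distrib,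
    Finset.sum_eq_sum_iff_of_le fun r _ => pairLength_lam_pow_le hk hke y r.1 r.2] at hy
  have hpair : pairLength (lam e n ^ k * y) j i = 2 := by
    simp only [pairLength, hji, hlt.not_gt, hi, if_true, if_false]
  have hpair_y : pairLength y j i = 0 := by
    have hsum : pairLength (lam e n ^ k) j i =
        pairLength (lam e n ^ k * y) j i + pairLength y j i := hy (j, i) (Finset.mem_univ _)
    rw [pairLength_lam_pow hk hke hji, hpair] at hsum
    omega
  have hentry : geenEntry y i = 1 := by
    rw [geenPerm_mul, geenPerm_lam_pow, mul_one] at hlt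
    by_contra hentry
    simp [pairLength, hji, hlt.not_gt, hentry] at hpair_y
  rw [geenEntry_mul, geenPerm_lam_pow, Equiv.Perm.one_apply, hentry, mul_one,
    geenEntry_lam_pow k (Nat.ne_zero_of_lt hji)]

theorem geenEntry_of_mem_lengthInterval (hn : 2 ≤ n) (hk : 1 ≤ k) (hke : k ≤ e - 1) {x : Geen e n}
    (hx : x ∈ lengthInterval (corranPicantinGens e n) (lam e n ^ k)) {j i : Fin n}
    (hji : j < i) (hlt : geenPerm x j < geenPerm x i) (hi : geenEntry x i ≠ 1) :
    geenEntry x i = zetaRoot e ^ k := by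
  have he : 0 < e := by omega
  obtain ⟨y, rfl⟩ : ∃ y, x = lam e n ^ k * y := ⟨(lam e n ^ k)⁻¹ * x, by simp⟩
  refine geenEntry_of_geenLength_add hk hke ?_ hji hlt hi
  have hlen := lengthDvd_iff.1 (mem_lengthInterval.1 hx)
  rw [show (lam e n ^ k * y)⁻¹ * lam e n ^ k = y⁻¹ by group,
    wordLength_corranPicantinGens_inv he hn] at hlen
  simpa only [wordLength_eq_geenLength he hn] using hlen

end Lambda

/-! ### Joins of generators -/

section Joins

variable {e n k : ℕ}

namespace IsRowSwap

variable {s t x : Geen e n} {p q r p' q' : Fin n} {z z' : ℂ}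

theorem mul_comm_of_lt (hs : IsRowSwap s p q z) (ht : IsRowSwap t p' q' z') (hlt : q < p') :
    s * t = t * s := by
  have hpq := hs.lt
  have hpq' := ht.lt
  have hpp' := hpq.trans hlt
  refine geen_ext (fun i => ?_) fun i => ?_
  · simp only [hs.perm_mul, ht.perm_mul, hs.perm, ht.perm, Equiv.swap_apply_def]
    grind
  · simp only [hs.entry_mul, ht.entry_mul, hs.entry, ht.entry, rowSwapEntry]
    grind

theorem isDescent_mul_iff_of_disjoint (hs : IsRowSwap s p q z) (hp : p' ≠ p) (hp' : p' ≠ q)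
    (hq : q' ≠ p) (hq' : q' ≠ q) : IsDescent (s * x) p' q' z' ↔ IsDescent x p' q' z' := by
  simp only [IsDescent, hs.perm_mul, hs.entry_mul, hp, hp', hq, hq', if_false]

theorem mul_mul_braid (hs : IsRowSwap s p q z) (ht : IsRowSwap t q r 1) :
    s * (t * s) = t * (s * t) := by
  have hpq := hs.lt
  have hqr := ht.lt
  have hz := hs.scalar_ne_zero
  refine geen_ext (fun i => ?_) fun i => ?_
  · simp only [hs.perm_mul, ht.perm_mul, hs.perm, ht.perm, Equiv.swap_apply_def]
    grind
  · simp only [hs.entry_mul, ht.entry_mul, hs.entry, ht.entry, rowSwapEntry]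
    grind

theorem isDescent_mul_of_braid (hs : IsRowSwap s p q z) (ht : IsRowSwap t q r 1)
    (hxs : IsDescent x p q z) (hxt : IsDescent x q r 1) : IsDescent (s * x) q r 1 := by
  have hpr : p ≠ r := (hs.lt.trans ht.lt).ne
  simp only [IsDescent, hs.perm_mul, hs.entry_mul, hs.ne.symm, ht.ne.symm, hpr.symm, if_false,
    if_true, one_mul] at hxs hxt ⊢
  rcases hxs with ⟨hqp, hp⟩ | ⟨hpq, hq⟩ <;> rcases hxt with ⟨hrq, hq'⟩ | ⟨hqr, hr⟩
  · exact Or.inl ⟨hrq.trans hqp, hp⟩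
  · exact ((geenPerm x).injective.ne hpr).lt_or_gt.elim
      (fun h => Or.inr ⟨h, hr⟩) fun h => Or.inl ⟨h, hp⟩
  · exact absurd hq' hq
  · exact Or.inr ⟨hpq.trans hqr, hr⟩

theorem isDescent_mul_mul_of_braid (hs : IsRowSwap s p q z) (ht : IsRowSwap t q r 1)
    (hxt : IsDescent x q r 1) : IsDescent (t * (s * x)) p q z := by
  have hpr : p ≠ r := (hs.lt.trans ht.lt).ne
  simpa [IsDescent, ht.perm_mul, ht.entry_mul, hs.perm_mul, hs.entry_mul, hs.ne, ht.ne, hpr,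
    hs.ne.symm, ht.ne.symm, hpr.symm, hs.scalar_ne_zero] using hxt

theorem mul_eq_mul_of_scalar_div (hs : IsRowSwap s p q z) (ht : IsRowSwap t p q z') {a b : Geen e n}
    {c : ℂ} (ha : IsRowSwap a p q (z / c)) (hb : IsRowSwap b p q (z' / c)) :
    s * a = t * b := by
  have hz := hs.scalar_ne_zero
  have hz' := ht.scalar_ne_zero
  refine geen_ext (fun i => ?_) fun i => ?_
  · rw [geenPerm_mul, geenPerm_mul, hs.perm, ht.perm, ha.perm, hb.perm]
  · simp only [hs.entry_mul, ht.entry_mul, ha.entry, hb.entry, rowSwapEntry, hs.ne.symm, if_true,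
      if_false]
    split_ifs <;> field_simp

end IsRowSwap

theorem IsDescent.lt_and_entry_ne_one {x : Geen e n} {p q : Fin n} {z z' : ℂ}
    (hz : IsDescent x p q z) (hz' : IsDescent x p q z') (hne : z ≠ z') :
    geenPerm x p < geenPerm x q ∧ geenEntry x q ≠ 1 := by
  rcases hz with ⟨-, hz⟩ | hx
  · rcases hz' with ⟨-, hz'⟩ | hx
    · exact absurd (mul_right_cancel₀ (geenEntry_ne_zero x p) (hz.trans hz'.symm)) hne
    · exact hx
  · exact hx

section GeneratorJoins

variable {s t : lengthInterval (corranPicantinGens e n) (lam e n ^ k)} {p q r p' q' : Fin n}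
  {z z' : ℂ}

theorem exists_join_of_commute (he : 0 < e) (hs : IsRowSwap s.1 p q z)
    (ht : IsRowSwap t.1 p' q' z') (hlt : q < p') : ∃ j, IsLcmFor IntervalDvd s t j := by
  refine exists_join_of_mul_eq (closure_corranPicantinGens he) (hs.mul_comm_of_lt ht hlt)
    (by rw [add_comm]) fun x _ _ hxt => ?_
  rw [ht.lengthDvd_iff he] at hxt ⊢
  rw [hs.inv_eq]
  exact (hs.isDescent_mul_iff_of_disjoint (hs.lt.trans hlt).ne' hlt.ne'
    (hs.lt.trans (hlt.trans ht.lt)).ne' (hlt.trans ht.lt).ne').2 hxt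

theorem exists_join_of_braid (he : 0 < e) (hs : IsRowSwap s.1 p q z)
    (ht : IsRowSwap t.1 q r z') : ∃ j, IsLcmFor IntervalDvd s t j := by
  have hS := closure_corranPicantinGens (n := n) he
  obtain rfl : z' = 1 := ht.scalar (by have := hs.succ; omega)
  have hlen : wordLength (corranPicantinGens e n) (s.1 * t.1) =
      wordLength (corranPicantinGens e n) (t.1 * s.1) := by
    rw [← wordLength_corranPicantinGens_inv he hs.two_le, mul_inv_rev, hs.inv_eq, ht.inv_eq]
  refine exists_join_of_mul_eq hS (hs.mul_mul_braid ht)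
    (by rw [hlen, hs.wordLength_eq he, ht.wordLength_eq he]) fun x _ hxs hxt => ?_
  rw [hs.lengthDvd_iff he] at hxs
  rw [ht.lengthDvd_iff he] at hxt
  have ht_dvd : LengthDvd (corranPicantinGens e n) t.1 (s.1⁻¹ * x) := by
    rw [ht.lengthDvd_iff he, hs.inv_eq]
    exact hs.isDescent_mul_of_braid ht hxs hxt
  refine ht_dvd.mul_of_quotient hS ?_
  rw [hs.lengthDvd_iff he, hs.inv_eq, ht.inv_eq]
  exact hs.isDescent_mul_mul_of_braid ht hxt

theorem exists_join_of_scalar_ne (hk : 1 ≤ k) (hke : k ≤ e - 1) (hs : IsRowSwap s.1 p q z)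
    (ht : IsRowSwap t.1 p q z') (hne : z ≠ z') : ∃ j, IsLcmFor IntervalDvd s t j := by
  have he : 0 < e := by omega
  have hp : ¬p.val ≠ 0 := fun hp => hne ((hs.scalar hp).trans (ht.scalar hp).symm)
  obtain ⟨a, ha⟩ := exists_isRowSwap he (z := z / zetaRoot e ^ k) hs.succ
    (by rw [div_pow, zetaRoot_pow_pow, hs.pow_eq, div_one]) (absurd · hp)
  obtain ⟨b, hb⟩ := exists_isRowSwap he (z := z' / zetaRoot e ^ k) hs.succ
    (by rw [div_pow, zetaRoot_pow_pow, ht.pow_eq, div_one]) (absurd · hp)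
  refine exists_join_of_mul_eq (closure_corranPicantinGens he)
    (hs.mul_eq_mul_of_scalar_div ht ha hb)
    (by rw [hs.wordLength_eq he, ht.wordLength_eq he, ha.wordLength_eq he, hb.wordLength_eq he])
    fun x hx hxs hxt => ?_
  rw [hs.lengthDvd_iff he] at hxs
  rw [ht.lengthDvd_iff he] at hxt
  rw [ha.lengthDvd_iff he, hs.inv_eq]
  obtain ⟨hlt, hentry⟩ := hxs.lt_and_entry_ne_one hxt hne
  have hζ := geenEntry_of_mem_lengthInterval hs.two_le hk hke hx hs.lt hlt hentry
  refine Or.inl ?_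
  simp only [hs.perm_mul, hs.entry_mul, hs.ne.symm, if_true, if_false, hζ]
  have hz := hs.scalar_ne_zero
  have hζ0 := zetaRoot_ne_zero e
  exact ⟨hlt, by field_simp⟩

theorem exists_join_of_le (hk : 1 ≤ k) (hke : k ≤ e - 1) (hs : IsRowSwap s.1 p q z)
    (ht : IsRowSwap t.1 p' q' z') (hle : p ≤ p') : ∃ j, IsLcmFor IntervalDvd s t j := by
  have he : 0 < e := by omega
  have hpq := hs.succ
  have hpq' := ht.succ
  rcases hle.eq_or_lt with rfl | hlt
  · obtain rfl : q = q' := Fin.ext (by omega)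
    by_cases hz : z = z'
    · subst hz
      obtain rfl : s = t := Subtype.ext (hs.eq_of_scalar_eq ht)
      exact ⟨s, LengthDvd.refl _, LengthDvd.refl _, fun _ h _ => h⟩
    · exact exists_join_of_scalar_ne hk hke hs ht hz
  · have hqp' : q ≤ p' := Fin.le_def.2 (by rw [Fin.lt_def] at hlt; omega)
    rcases hqp'.eq_or_lt with rfl | hlt
    · exact exists_join_of_braid he hs ht
    · exact exists_join_of_commute he hs ht hlt

end GeneratorJoins

theorem isGarsideInterval_lam_pow (hn : 2 ≤ n) (hk : 1 ≤ k) (hke : k ≤ e - 1) :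
    IsGarsideInterval (corranPicantinGens e n) (lam e n ^ k) := by
  have he : 0 < e := by omega
  have hS := closure_corranPicantinGens (n := n) he
  have hbal := isBalanced_lam_pow he hn k
  refine ⟨hS, hbal, hbal.exists_join_of_generators hS fun s t hs ht => ?_⟩
  obtain ⟨p, q, z, hs⟩ := exists_isRowSwap_of_mem hn hs
  obtain ⟨p', q', z', ht⟩ := exists_isRowSwap_of_mem hn ht
  rcases le_total p p' with hle | hle
  · exact exists_join_of_le hk hke hs ht hle
  · obtain ⟨j, htj, hsj, hj⟩ := exists_join_of_le hk hke ht hs hle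
    exact ⟨j, hsj, htj, fun c hsc htc => hj c htc hsc⟩

end Joins

theorem mainTheorem2 (e n k : ℕ) (hn : 2 ≤ n) (hk : 1 ≤ k) (hke : k ≤ e - 1) :
    IsGarsideMonoid (IntervalMonoid (corranPicantinGens e n) (lam e n ^ k))
        (intervalTop (corranPicantinGens e n) (lam e n ^ k)) ∧
      Function.Injective (intervalCopy (corranPicantinGens e n) (lam e n ^ k)) ∧
      garsideSimples (intervalTop (corranPicantinGens e n) (lam e n ^ k)) =
        Set.range (intervalCopy (corranPicantinGens e n) (lam e n ^ k)) ∧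
      ∃ (Γ : Type) (_ : Group Γ)
        (ι : IntervalMonoid (corranPicantinGens e n) (lam e n ^ k) →* Γ),
        IsGroupOfFractions ι := by
  have hΔ := isGarsideInterval_lam_pow hn hk hke
  have : Finite (Geen e n) := finite_geen (by omega)
  have hM := hΔ.isGarsideMonoid (Set.toFinite _)
  exact ⟨hM, intervalCopy_injective _ _, hΔ.garsideSimples_intervalTop,
    hM.exists_isGroupOfFractions⟩
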